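/- Fix integers $k\ge 1$ and $b\ge 1$. A \emph{$k$-caterpillar} is a graph obtained from a path $P$ with at least one vertex (the spine) by attaching to its vertices finitely many (possibly zero) legs; a leg at $u\in V(P)$ is a path of length at least $1$ and at most $k$ that starts at $u$ and whose other vertices are new (they are not on $P$ or on any other leg). Let $G=(V,E)$ be a finite simple graph, $s\in V$ the vertex where the fire breaks out. A protection strategy is a set $\Phi\subseteq V\times\{1,\dots,|V|\}$, where $(v,t)\in\Phi$ means that $v$ is protected at time $t$. Only $s$ is burned at times $0$ and $1$. For each $t\ge 1$, the vertices burned at time $t+1$ are those burned at time $t$, together with every vertex that is adjacent to a vertex burned at time $t$ and has not been protected at time $t$ or before. The strategy $\Phi$ is valid with respect to the budget $b$ if $v$ is not burned at time $t$ whenever $(v,t)\in\Phi$, and if for each $t$ there are at most $b$ vertices $v$ with $(v,t)\in\Phi$. A vertex is saved by $\Phi$ if it is never burned. \textsc{Max Weighted $b$-Save}: given a graph $G=(V,E)$, a vertex $s\in V$, a set $S\subseteq V$ and a weight function $w:S\to\mathbb N$, output a strategy $\Phi$, valid with respect to the budget $b$, which maximizes the total weight $\sum_{v\in S,\ v\text{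 saved by }\Phi} w(v)$ among all valid strategies. \textbf{Theorem.} For any fixed $k\ge 1$ and $b\ge 1$, \textsc{Max Weighted $b$-Save} is polynomial-time solvable on $k$-caterpillars: there is an algorithm (a program of a random access machine with addition and subtraction at unit cost) which, for every instance $(G,s,S,w)$ such that $G$ is a $k$-caterpillar, outputs an optimal valid strategy within a number of steps that is polynomial in the bit length of the instance ($G$ being given by its adjacency matrix, and the weights in binary). -/

import Mathlib

/-! ### Polynomial time: a random access machine with a step count

Programs are `while`-programs over finitely many integer variables and finitely many unbounded
arrays of natural numbers with indirect addressing. Every elementary operation costs one step. The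
only arithmetic operations are addition and truncated subtraction (no multiplication), so each step
lengthens the numbers in memory by a bounded number of bits and unit cost is polynomially
equivalent to counting steps of a Turing machine. -/

namespace RAM

/-- Memory: variables `vars x` and arrays `arrs a`, with cells `arrs a i`. -/
structure State where
  vars : ℕ → ℕ
  arrs : ℕ → ℕ → ℕ

/-- Arithmetic expressions. Variables and arrays are named by fixed numbers in the program text;
the index of an array cell is computed. -/
inductive Expr : Type
  | const (c : ℕ) : Expr
  | var (x : ℕ) : Expr
  | get (a : ℕ) (i : Expr) : Expr
  | add (e f : Expr) : Expr
  | sub (e f : Expr) : Expr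

/-- The value of an expression (`sub` is truncated subtraction). -/
def Expr.eval (σ : State) : Expr → ℕ
  | .const c => c
  | .var x => σ.vars x
  | .get a i => σ.arrs a (i.eval σ)
  | .add e f => e.eval σ + f.eval σ
  | .sub e f => e.eval σ - f.eval σ

/-- The number of elementary operations in the evaluation of an expression. -/
def Expr.cost : Expr → ℕ
  | .const _ => 1
  | .var _ => 1
  | .get _ i => i.cost + 1
  | .add e f => e.cost + f.cost + 1
  | .sub e f => e.cost + f.cost + 1

/-- Programs. A test `e` succeeds if the value of `e` is not `0`. -/
inductive Cmd : Type
  | skip : Cmd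
  | assign (x : ℕ) (e : Expr) : Cmd
  | store (a : ℕ) (i e : Expr) : Cmd
  | seq (c d : Cmd) : Cmd
  | ite (e : Expr) (c d : Cmd) : Cmd
  | loop (e : Expr) (c : Cmd) : Cmd

/-- `Run c σ t τ`: the program `c`, started in the state `σ`, halts after exactly `t` steps in the
state `τ`. The command `loop e c` is the loop `while e ≠ 0 do c`. -/
inductive Run : Cmd → State → ℕ → State → Prop
  | skip (σ : State) : Run .skip σ 1 σ
  | assign (x : ℕ) (e : Expr) (σ : State) :
      Run (.assign x e) σ (e.cost + 1)
        { σ with vars := Function.update σ.vars x (e.eval σ) }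
  | store (a : ℕ) (i e : Expr) (σ : State) :
      Run (.store a i e) σ (i.cost + e.cost + 1)
        { σ with
          arrs := Function.update σ.arrs a
            (Function.update (σ.arrs a) (i.eval σ) (e.eval σ)) }
  | seq {c d : Cmd} {σ τ ρ : State} {t u : ℕ} :
      Run c σ t τ → Run d τ u ρ → Run (.seq c d) σ (t + u) ρ
  | ite_true {e : Expr} {c d : Cmd} {σ τ : State} {t : ℕ} :
      e.eval σ ≠ 0 → Run c σ t τ → Run (.ite e c d) σ (e.cost + 1 + t) τ
  | ite_false {e : Expr} {c d : Cmd} {σ τ : State} {t : ℕ} :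
      e.eval σ = 0 → Run d σ t τ → Run (.ite e c d) σ (e.cost + 1 + t) τ
  | loop_true {e : Expr} {c : Cmd} {σ τ ρ : State} {t u : ℕ} :
      e.eval σ ≠ 0 → Run c σ t τ → Run (.loop e c) τ u ρ →
        Run (.loop e c) σ (e.cost + 1 + t + u) ρ
  | loop_false {e : Expr} {c : Cmd} {σ : State} :
      e.eval σ = 0 → Run (.loop e c) σ (e.cost + 1) σ

/-- The initial state on the input `xs`: array `0` holds the entries of `xs`, variable `0` holds
its length, and everything else is `0`. -/
def initState (xs : List ℕ) : State where
  vars := fun x => if x = 0 then xs.length else 0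
  arrs := fun a i => if a = 0 then xs.getD i 0 else 0

/-- The output read off a final state: the first `vars 1` entries of array `1`. -/
def State.output (σ : State) : List ℕ :=
  (List.range (σ.vars 1)).map (σ.arrs 1)

/-- The length of the input `xs` in bits, numbers being written in binary (with one additional bit
for each entry as a separator). -/
def bitLength (xs : List ℕ) : ℕ :=
  (xs.map fun x => Nat.size x + 1).sum

/-- A search problem is given by its instances, an encoding `enc` of these, and the relation
`R x ys`: the word `ys` is a correct answer to the instance `x`. It is solvable in polynomial time
if one program answers every instance correctly in time (including the time for printing the
answer) polynomial in the bit length of the encoded instance. -/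
def SolvableInPolyTime {ι : Type} (enc : ι → List ℕ) (R : ι → List ℕ → Prop) : Prop :=
  ∃ (c : Cmd) (p : Polynomial ℕ), ∀ x : ι, ∃ (t : ℕ) (τ : State),
    Run c (initState (enc x)) t τ ∧
      t + τ.output.length ≤ p.eval (bitLength (enc x)) ∧ R x τ.output

end RAM

/-! ### The firefighter process -/

namespace Firefighter

/-- The set of vertices on fire at time `t`, when the fire breaks out at `s` and `(v, i) ∈ Φ` means
that `v` is protected at time `i`. Only `s` is on fire at times `0` and `1`; from each time `t ≥ 1`
to time `t + 1` the fire spreads to every neighbour of a burned vertex that has not been protected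
at time `t` or before. -/
def burned {V : Type} (G : SimpleGraph V) (s : V) (Φ : Finset (V × ℕ)) : ℕ → Set V
  | 0 => {s}
  | t + 1 => burned G s Φ t ∪
      {v | 1 ≤ t ∧ (∃ u ∈ burned G s Φ t, G.Adj u v) ∧ ∀ i ≤ t, (v, i) ∉ Φ}

/-- The vertices which are not on fire when the process has ended. -/
def Saved {V : Type} (G : SimpleGraph V) (s : V) (Φ : Finset (V × ℕ)) (v : V) : Prop :=
  ∀ t, v ∉ burned G s Φ t

/-- `Φ ⊆ V × {1, …, |V|}` is a protection strategy which is valid with respect to the budget `b`: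
no vertex is protected when it is on fire, and at most `b` vertices are protected at each time. -/
def IsValidStrategy {V : Type} [Fintype V] (G : SimpleGraph V) (s : V) (b : ℕ)
    (Φ : Finset (V × ℕ)) : Prop :=
  (∀ q ∈ Φ, 1 ≤ q.2 ∧ q.2 ≤ Fintype.card V) ∧
  (∀ q ∈ Φ, q.1 ∉ burned G s Φ q.2) ∧
  (∀ t : ℕ, (Φ.filter fun q => q.2 = t).card ≤ b)

/-- An instance of Max Weighted `b`-Save: a graph on the vertices `0, …, n - 1`, the vertex `s`
where the fire breaks out, a set `S` of vertices, and a weight function `w : S → ℕ`. -/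
structure Instance where
  n : ℕ
  G : SimpleGraph (Fin n)
  s : Fin n
  S : Finset (Fin n)
  w : {v : Fin n // v ∈ S} → ℕ

open Classical in
/-- The total weight of the vertices in `S` saved by the strategy `Φ`. -/
noncomputable def Instance.value (I : Instance) (Φ : Finset (Fin I.n × ℕ)) : ℕ :=
  ∑ v : {v : Fin I.n // v ∈ I.S}, if Saved I.G I.s Φ v.1 then I.w v else 0

/-- `Φ` is an optimal solution of Max Weighted `b`-Save. -/
def Instance.IsOptimal (I : Instance) (b : ℕ) (Φ : Finset (Fin I.n × ℕ)) : Prop :=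
  IsValidStrategy I.G I.s b Φ ∧
    ∀ Ψ : Finset (Fin I.n × ℕ), IsValidStrategy I.G I.s b Ψ → I.value Ψ ≤ I.value Φ

open Classical in
/-- An instance as a list of numbers: `n`, `s`, the adjacency matrix row by row, the indicator
vector of `S`, and the weights (with the entry `0` for vertices outside `S`). -/
noncomputable def Instance.encode (I : Instance) : List ℕ :=
  [I.n, I.s.val] ++
  ((List.finRange I.n).flatMap fun i =>
    (List.finRange I.n).map fun j => if I.G.Adj i j then 1 else 0) ++
  ((List.finRange I.n).map fun v => if v ∈ I.S then 1 else 0) ++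
  ((List.finRange I.n).map fun v => if h : v ∈ I.S then I.w ⟨v, h⟩ else 0)

/-- A list of pairs `(v₁, t₁), (v₂, t₂), …` as the list of numbers `v₁, t₁, v₂, t₂, …`. -/
def encodePairs {n : ℕ} (L : List (Fin n × ℕ)) : List ℕ :=
  L.flatMap fun q => [q.1.val, q.2]

/-! ### `k`-caterpillars -/

/-- The vertices of a spine `0, 1, …, p - 1` together with `m` legs, where the leg `j` consists of
`len j` vertices `⟨j, 0⟩, ⟨j, 1⟩, …` off the spine. -/
abbrev SpineLegs (p m : ℕ) (len : Fin m → ℕ) : Type :=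
  Fin p ⊕ (Σ j : Fin m, Fin (len j))

/-- The edges of the spine with legs, each in one direction: the spine is a path, and the leg `j`
is a path of length `len j` which starts at the spine vertex `foot j`. -/
def spineLegsRel {p m : ℕ} (foot : Fin m → Fin p) (len : Fin m → ℕ) :
    SpineLegs p m len → SpineLegs p m len → Prop
  | .inl i, .inl i' => i.val + 1 = i'.val
  | .inl i, .inr x => foot x.1 = i ∧ x.2.val = 0
  | .inr x, .inr y => x.1 = y.1 ∧ x.2.val + 1 = y.2.val
  | .inr _, .inl _ => False

/-- The graph consisting of a spine on `p` vertices with a leg of length `len j` at the spine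
vertex `foot j`, for each `j`: it arises from the caterpillar with spine `0, …, p - 1` and a pending
edge at `foot j` for each `j`, if the pending edge `j` is replaced by a path of length `len j`. -/
def spineLegsGraph {p m : ℕ} (foot : Fin m → Fin p) (len : Fin m → ℕ) :
    SimpleGraph (SpineLegs p m len) :=
  SimpleGraph.fromRel (spineLegsRel foot len)

/-- `G` is a `k`-caterpillar: a caterpillar in which each pending edge is replaced by a path of
length at least `1` and at most `k`. -/
def IsCaterpillar {V : Type} (k : ℕ) (G : SimpleGraph V) : Prop :=
  ∃ (p m : ℕ) (foot : Fin m → Fin p) (len : Fin m → ℕ),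
    1 ≤ p ∧ (∀ j, 1 ≤ len j ∧ len j ≤ k) ∧ Nonempty (G ≃g spineLegsGraph foot len)

end Firefighter

namespace RAM

/-! ### Running programs -/

/-- Assigning a value to a variable. -/
def State.set (σ : State) (x v : ℕ) : State := { σ with vars := Function.update σ.vars x v }

/-- Assigning a value to an array cell. -/
def State.put (σ : State) (a i v : ℕ) : State :=
  { σ with arrs := Function.update σ.arrs a (Function.update (σ.arrs a) i v) }

@[simp] theorem State.set_vars_self (σ : State) (x v : ℕ) : (σ.set x v).vars x = v := by
  simp [State.set]

theorem State.set_vars_ne (σ : State) {x v y : ℕ} (h : y ≠ x) :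
    (σ.set x v).vars y = σ.vars y := by
  simp [State.set, h]

@[simp] theorem State.set_arrs (σ : State) (x v : ℕ) : (σ.set x v).arrs = σ.arrs := rfl

@[simp] theorem State.put_vars (σ : State) (a i v : ℕ) : (σ.put a i v).vars = σ.vars := rfl

theorem State.put_arrs_ne (σ : State) {a i v a' : ℕ} (h : a' ≠ a) :
    (σ.put a i v).arrs a' = σ.arrs a' := by
  simp [State.put, h]

theorem State.put_arrs_self (σ : State) (a i v j : ℕ) :
    (σ.put a i v).arrs a j = if j = i then v else σ.arrs a j := by
  simp [State.put, Function.update_apply]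

/-- The program `c`, started in `σ`, halts within `T` steps in a state with the property `Q`. -/
def Halts (c : Cmd) (σ : State) (T : ℕ) (Q : State → Prop) : Prop :=
  ∃ t τ, Run c σ t τ ∧ t ≤ T ∧ Q τ

theorem Halts.mono {c : Cmd} {σ : State} {T U : ℕ} {Q R : State → Prop} (h : Halts c σ T Q)
    (hT : T ≤ U) (hQ : ∀ τ, Q τ → R τ) : Halts c σ U R := by
  obtain ⟨t, τ, h1, h2, h3⟩ := h
  exact ⟨t, τ, h1, h2.trans hT, hQ τ h3⟩

theorem Halts.seq {c d : Cmd} {σ : State} {T U : ℕ} {Q : State → Prop}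
    (h : Halts c σ T fun τ => Halts d τ U Q) : Halts (.seq c d) σ (T + U) Q := by
  obtain ⟨t, τ, h1, h2, u, υ, h3, h4, h5⟩ := h
  exact ⟨t + u, υ, .seq h1 h3, by omega, h5⟩

theorem Halts.assign {x : ℕ} {e : Expr} {σ : State} {Q : State → Prop}
    (h : Q (σ.set x (e.eval σ))) : Halts (.assign x e) σ (e.cost + 1) Q :=
  ⟨_, _, .assign x e σ, le_rfl, h⟩

theorem Halts.store {a : ℕ} {i e : Expr} {σ : State} {Q : State → Prop}
    (h : Q (σ.put a (i.eval σ) (e.eval σ))) :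
    Halts (.store a i e) σ (i.cost + e.cost + 1) Q :=
  ⟨_, _, .store a i e σ, le_rfl, h⟩

theorem Halts.skip {σ : State} {Q : State → Prop} (h : Q σ) : Halts .skip σ 1 Q :=
  ⟨_, _, .skip σ, le_rfl, h⟩

theorem Halts.ite {e : Expr} {c d : Cmd} {σ : State} {T : ℕ} {Q : State → Prop}
    (h1 : e.eval σ ≠ 0 → Halts c σ T Q) (h2 : e.eval σ = 0 → Halts d σ T Q) :
    Halts (.ite e c d) σ (e.cost + 1 + T) Q := by
  by_cases h : e.eval σ = 0
  · obtain ⟨t, τ, h3, h4, h5⟩ := h2 h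
    exact ⟨_, τ, .ite_false h h3, by omega, h5⟩
  · obtain ⟨t, τ, h3, h4, h5⟩ := h1 h
    exact ⟨_, τ, .ite_true h h3, by omega, h5⟩

/-- The loop `for x = 0, …, y - 1 do c`. -/
def forLoop (x y : ℕ) (c : Cmd) : Cmd :=
  .seq (.assign x (.const 0))
    (.loop (.sub (.var y) (.var x)) (.seq c (.assign x (.add (.var x) (.const 1)))))

/-- Each round pays `4` for the test and `4` for the increment on top of the body; the constant `6`
is the initial assignment and the last, failing test. The invariant is required after the increment
because it may mention the counter. -/
theorem Halts.forLoop {x y : ℕ} {c : Cmd} {B T : ℕ} (Inv : ℕ → State → Prop) {σ : State}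
    (hxy : y ≠ x)
    (hc : ∀ i < B, ∀ σ, Inv i σ → σ.vars x = i → σ.vars y = B →
      Halts c σ T fun τ => τ.vars x = i ∧ τ.vars y = B ∧ Inv (i + 1) (τ.set x (i + 1)))
    (h0 : Inv 0 (σ.set x 0)) (hy : σ.vars y = B) :
    Halts (RAM.forLoop x y c) σ (B * (T + 8) + 6) (Inv B) := by
  have key : ∀ r i, i + r = B → ∀ σ : State, Inv i σ → σ.vars x = i → σ.vars y = B →
      Halts (.loop (.sub (.var y) (.var x)) (.seq c (.assign x (.add (.var x) (.const 1))))) σ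
        (r * (T + 8) + 4) (Inv B) := by
    intro r
    induction r with
    | zero =>
      intro i hi σ h1 h2 h3
      refine ⟨_, σ, .loop_false ?_, ?_, ?_⟩
      · simp only [Expr.eval]; omega
      · simp [Expr.cost]
      · obtain rfl : i = B := by omega
        exact h1
    | succ r ih =>
      intro i hi σ h1 h2 h3
      obtain ⟨t, τ, h4, h5, h6, h7, h8⟩ := hc i (by omega) σ h1 h2 h3
      have h9 := ih (i + 1) (by omega) (τ.set x (i + 1)) h8 (by simp)
        (by rw [State.set_vars_ne _ hxy, h7])
      obtain ⟨u, υ, h10, h11, h12⟩ := h9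
      have h13 := Run.assign x (.add (.var x) (.const 1)) τ
      simp only [Expr.eval, h6] at h13
      refine ⟨_, υ, .loop_true (τ := τ.set x (i + 1)) ?_ (.seq h4 h13) h10, ?_, h12⟩
      · simp only [Expr.eval]; omega
      · simp only [Expr.cost]
        have : (r + 1) * (T + 8) = r * (T + 8) + (T + 8) := by ring
        omega
  have h := key B 0 (by simp) (σ.set x 0) h0 (by simp) (by rw [State.set_vars_ne _ hxy, hy])
  refine Halts.mono (Halts.seq (T := 2) (U := B * (T + 8) + 4) (Halts.assign ?_)) (by omega)
    fun _ => id
  simpa [Expr.eval] using h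

/-- The states `σ` and `τ` agree on the variables below `d` and on the arrays below `a`. -/
def Frame (d a : ℕ) (σ τ : State) : Prop :=
  (∀ x < d, τ.vars x = σ.vars x) ∧ ∀ x < a, τ.arrs x = σ.arrs x

theorem Frame.refl (d a : ℕ) (σ : State) : Frame d a σ σ := ⟨fun _ _ => rfl, fun _ _ => rfl⟩

theorem Frame.trans {d a : ℕ} {σ τ υ : State} (h : Frame d a σ τ) (h' : Frame d a τ υ) :
    Frame d a σ υ :=
  ⟨fun x hx => (h'.1 x hx).trans (h.1 x hx), fun x hx => (h'.2 x hx).trans (h.2 x hx)⟩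

theorem Frame.mono {d a d' a' : ℕ} {σ τ : State} (h : Frame d' a' σ τ) (hd : d ≤ d')
    (ha : a ≤ a') : Frame d a σ τ :=
  ⟨fun x hx => h.1 x (by omega), fun x hx => h.2 x (by omega)⟩

theorem Frame.set {d a : ℕ} {σ τ : State} (h : Frame d a σ τ) {x : ℕ} (hx : d ≤ x) (v : ℕ) :
    Frame d a σ (τ.set x v) :=
  ⟨fun y hy => by rw [State.set_vars_ne _ (by omega), h.1 y hy], h.2⟩

/-! ### Functions computable in polynomial time -/

variable {ι : Type} {enc : ι → List ℕ}

/-- The array `0` of the state `σ` holds the encoded instance `I`. -/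
def Inp (enc : ι → List ℕ) (I : ι) (σ : State) : Prop := σ.arrs 0 = fun i => (enc I).getD i 0

theorem Inp.frame {I : ι} {σ τ : State} (h : Inp enc I σ) {d a : ℕ} (ha : 0 < a)
    (hf : Frame d a σ τ) : Inp enc I τ := (hf.2 0 ha).trans h

/-- `f I A v` can be computed in time polynomial in the length of the instance `I`, where the
oracle `A` is given as an array and the arguments `v` are given in variables. -/
def PT (enc : ι → List ℕ) {m : ℕ} (f : ι → (ℕ → ℕ) → (Fin m → ℕ) → ℕ) : Prop :=
  ∀ (o : ℕ) (ρ : Fin m → ℕ) (d a : ℕ), (∀ j, ρ j < d) → o < a → 0 < a →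
    ∃ (c : Cmd) (p : Polynomial ℕ), ∀ (I : ι) (σ : State), Inp enc I σ →
      Halts c σ (p.eval (bitLength (enc I))) fun τ =>
        Frame d a σ τ ∧ τ.vars d = f I (σ.arrs o) fun j => σ.vars (ρ j)

/-- A number, depending on the instance only, which can be computed in polynomial time and is
polynomially bounded. -/
def Bd (enc : ι → List ℕ) (B : ι → ℕ) : Prop :=
  PT enc (m := 0) (fun I _ _ => B I) ∧
    ∃ p : Polynomial ℕ, ∀ I, B I ≤ p.eval (bitLength (enc I))

namespace PT

variable {m : ℕ}

theorem congr {f g : ι → (ℕ → ℕ) → (Fin m → ℕ) → ℕ} (hf : PT enc f)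
    (h : ∀ I A v, g I A v = f I A v) : PT enc g := by
  have : g = f := by funext I A v; exact h I A v
  rwa [this]

theorem const (c : ℕ) : PT enc (m := m) fun _ _ _ => c := by
  intro o ρ d a hρ ho ha
  refine ⟨.assign d (.const c), Polynomial.C 2, fun I σ hI => ?_⟩
  refine (Halts.assign ?_).mono (by simp [Expr.cost]) fun _ => id
  exact ⟨(Frame.refl d a σ).set le_rfl _, by simp [Expr.eval]⟩

theorem var (j : Fin m) : PT enc fun _ _ v => v j := by
  intro o ρ d a hρ ho ha
  refine ⟨.assign d (.var (ρ j)), Polynomial.C 2, fun I σ hI => ?_⟩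
  refine (Halts.assign ?_).mono (by simp [Expr.cost]) fun _ => id
  exact ⟨(Frame.refl d a σ).set le_rfl _, by simp [Expr.eval]⟩

theorem reindex {m' : ℕ} {f : ι → (ℕ → ℕ) → (Fin m → ℕ) → ℕ} (hf : PT enc f)
    (r : Fin m → Fin m') : PT enc fun I A v => f I A fun j => v (r j) := by
  intro o ρ d a hρ ho ha
  exact hf o (fun j => ρ (r j)) d a (fun j => hρ _) ho ha

theorem unop {f : ι → (ℕ → ℕ) → (Fin m → ℕ) → ℕ} (hf : PT enc f) {e : ℕ → ℕ → Expr}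
    {F : ι → (ℕ → ℕ) → ℕ → ℕ} {C : ℕ}
    (he : ∀ I σ o d, Inp enc I σ → (e o d).eval σ = F I (σ.arrs o) (σ.vars d))
    (hC : ∀ o d, (e o d).cost ≤ C) : PT enc fun I A v => F I A (f I A v) := by
  intro o ρ d a hρ ho ha
  obtain ⟨c, p, h⟩ := hf o ρ d a hρ ho ha
  refine ⟨.seq c (.assign d (e o d)), p + Polynomial.C (C + 1), fun I σ hI => ?_⟩
  rw [Polynomial.eval_add, Polynomial.eval_C]
  refine Halts.seq ((h I σ hI).mono le_rfl ?_)
  rintro τ ⟨h1, h2⟩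
  refine (Halts.assign ?_).mono (Nat.add_le_add_right (hC o d) 1) fun _ => id
  refine ⟨h1.set le_rfl _, ?_⟩
  rw [State.set_vars_self, he I τ o d (hI.frame ha h1), h2, h1.2 o ho]

theorem oracle {f : ι → (ℕ → ℕ) → (Fin m → ℕ) → ℕ} (hf : PT enc f) :
    PT enc fun I A v => A (f I A v) :=
  hf.unop (e := fun o d => .get o (.var d)) (F := fun _ A x => A x) (C := 2)
    (fun _ _ _ _ _ => rfl) (fun _ _ => le_rfl)

theorem input {f : ι → (ℕ → ℕ) → (Fin m → ℕ) → ℕ} (hf : PT enc f) :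
    PT enc fun I A v => (enc I).getD (f I A v) 0 :=
  hf.unop (e := fun _ d => .get 0 (.var d)) (F := fun I _ x => (enc I).getD x 0) (C := 2)
    (fun I σ _ d h => by simp only [Expr.eval]; rw [h]) (fun _ _ => le_rfl)

/-- The second operand is computed with result register `d + 1`, so its frame condition protects the
first operand in `d`. -/
theorem binop {f g : ι → (ℕ → ℕ) → (Fin m → ℕ) → ℕ} (hf : PT enc f) (hg : PT enc g)
    {e : ℕ → ℕ → Expr} {F : ℕ → ℕ → ℕ}
    (he : ∀ σ x y, (e x y).eval σ = F (σ.vars x) (σ.vars y)) (hC : ∀ x y, (e x y).cost ≤ 3) :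
    PT enc fun I A v => F (f I A v) (g I A v) := by
  intro o ρ d a hρ ho ha
  obtain ⟨c, p, h⟩ := hf o ρ d a hρ ho ha
  obtain ⟨c', p', h'⟩ := hg o ρ (d + 1) a (fun j => (hρ j).trans (by omega)) ho ha
  refine ⟨.seq c (.seq c' (.assign d (e d (d + 1)))), p + (p' + Polynomial.C 4), fun I σ hI => ?_⟩
  rw [Polynomial.eval_add, Polynomial.eval_add, Polynomial.eval_C]
  refine Halts.seq ((h I σ hI).mono le_rfl ?_)
  rintro τ ⟨h1, h2⟩
  refine Halts.seq ((h' I τ (hI.frame ha h1)).mono le_rfl ?_)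
  rintro υ ⟨h3, h4⟩
  refine (Halts.assign ?_).mono (Nat.add_le_add_right (hC _ _) 1) fun _ => id
  refine ⟨(h1.trans (h3.mono (by omega) le_rfl)).set le_rfl _, ?_⟩
  rw [State.set_vars_self, he, h3.1 d (by omega), h2, h4, h1.2 o ho]
  congr 2
  funext j
  exact h1.1 _ (hρ j)

theorem add {f g : ι → (ℕ → ℕ) → (Fin m → ℕ) → ℕ} (hf : PT enc f) (hg : PT enc g) :
    PT enc fun I A v => f I A v + g I A v :=
  hf.binop hg (e := fun x y => .add (.var x) (.var y)) (F := fun x y => x + y)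
    (fun _ _ _ => rfl) (fun _ _ => le_rfl)

theorem sub {f g : ι → (ℕ → ℕ) → (Fin m → ℕ) → ℕ} (hf : PT enc f) (hg : PT enc g) :
    PT enc fun I A v => f I A v - g I A v :=
  hf.binop hg (e := fun x y => .sub (.var x) (.var y)) (F := fun x y => x - y)
    (fun _ _ _ => rfl) (fun _ _ => le_rfl)

theorem cond {c f g : ι → (ℕ → ℕ) → (Fin m → ℕ) → ℕ} (hc : PT enc c) (hf : PT enc f)
    (hg : PT enc g) : PT enc fun I A v => if c I A v = 0 then g I A v else f I A v := by
  intro o ρ d a hρ ho ha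
  obtain ⟨c0, p0, h0⟩ := hc o ρ d a hρ ho ha
  obtain ⟨c1, p1, h1⟩ := hf o ρ d a hρ ho ha
  obtain ⟨c2, p2, h2⟩ := hg o ρ d a hρ ho ha
  refine ⟨.seq c0 (.ite (.var d) c1 c2), p0 + (Polynomial.C 2 + (p1 + p2)), fun I σ hI => ?_⟩
  simp only [Polynomial.eval_add, Polynomial.eval_C]
  refine Halts.seq ((h0 I σ hI).mono le_rfl ?_)
  rintro τ ⟨h3, h4⟩
  have e : (fun j => τ.vars (ρ j)) = fun j => σ.vars (ρ j) := funext fun j => h3.1 _ (hρ j)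
  refine Halts.ite (e := .var d) (fun hne => ?_) fun heq => ?_
  · refine (h1 I τ (hI.frame ha h3)).mono (by omega) fun υ h5 => ⟨h3.trans h5.1, ?_⟩
    rw [h5.2, e, h3.2 o ho, if_neg]
    rwa [← h4]
  · refine (h2 I τ (hI.frame ha h3)).mono (by omega) fun υ h5 => ⟨h3.trans h5.1, ?_⟩
    rw [h5.2, e, h3.2 o ho, if_pos]
    rwa [← h4]

/-- The result register `d` of `g` becomes an argument register of `f`, which works above it. All
composition rules are instances of this. -/
theorem letIn {f : ι → (ℕ → ℕ) → (Fin (m + 1) → ℕ) → ℕ}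
    {g : ι → (ℕ → ℕ) → (Fin m → ℕ) → ℕ} (hf : PT enc f) (hg : PT enc g) :
    PT enc fun I A v => f I A (Fin.cons (g I A v) v) := by
  intro o ρ d a hρ ho ha
  obtain ⟨c, p, h⟩ := hg o ρ d a hρ ho ha
  obtain ⟨c', p', h'⟩ := hf o (Fin.cons d ρ) (d + 1) a
    (fun j => by
      refine Fin.cases ?_ (fun j => ?_) j
      · simp
      · simpa using (hρ j).trans (Nat.lt_succ_self d)) ho ha
  refine ⟨.seq c (.seq c' (.assign d (.var (d + 1)))), p + (p' + Polynomial.C 2), fun I σ hI => ?_⟩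
  rw [Polynomial.eval_add, Polynomial.eval_add, Polynomial.eval_C]
  refine Halts.seq ((h I σ hI).mono le_rfl ?_)
  rintro τ ⟨h1, h2⟩
  refine Halts.seq ((h' I τ (hI.frame ha h1)).mono le_rfl ?_)
  rintro υ ⟨h3, h4⟩
  refine (Halts.assign ?_).mono le_rfl fun _ => id
  refine ⟨(h1.trans (h3.mono (by omega) le_rfl)).set le_rfl _, ?_⟩
  rw [State.set_vars_self]
  simp only [Expr.eval]
  rw [h4, h1.2 o ho]
  congr 1
  funext j
  refine Fin.cases ?_ (fun j => ?_) j
  · simpa using h2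
  · simpa using h1.1 _ (hρ j)

theorem comp₁ {F : ι → ℕ → ℕ} (hF : PT enc (m := 1) fun I _ v => F I (v 0))
    {f : ι → (ℕ → ℕ) → (Fin m → ℕ) → ℕ} (hf : PT enc f) :
    PT enc fun I A v => F I (f I A v) :=
  (letIn (hF.reindex (m' := m + 1) fun _ => 0) hf).congr fun _ _ _ => by simp

theorem comp₂ {F : ι → ℕ → ℕ → ℕ} (hF : PT enc (m := 2) fun I _ v => F I (v 0) (v 1))
    {f g : ι → (ℕ → ℕ) → (Fin m → ℕ) → ℕ} (hf : PT enc f) (hg : PT enc g) :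
    PT enc fun I A v => F I (f I A v) (g I A v) :=
  (letIn (letIn (hF.reindex (m' := m + 2) ![0, 1]) (hf.reindex Fin.succ)) hg).congr
    fun _ _ _ => rfl

theorem comp₃ {F : ι → ℕ → ℕ → ℕ → ℕ}
    (hF : PT enc (m := 3) fun I _ v => F I (v 0) (v 1) (v 2))
    {f g h : ι → (ℕ → ℕ) → (Fin m → ℕ) → ℕ} (hf : PT enc f) (hg : PT enc g) (hh : PT enc h) :
    PT enc fun I A v => F I (f I A v) (g I A v) (h I A v) :=
  (letIn (letIn (letIn (hF.reindex (m' := m + 3) ![0, 1, 2])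
    ((hf.reindex Fin.succ).reindex Fin.succ)) (hg.reindex Fin.succ)) hh).congr
    fun _ _ _ => rfl

end PT

theorem Bd.pt {B : ι → ℕ} (hB : Bd enc B) {m : ℕ} : PT enc (m := m) fun I _ _ => B I :=
  hB.1.reindex Fin.elim0

end RAM

/-! ### Bounded recursion and tables computed row by row -/

namespace RAM

variable {ι : Type} {enc : ι → List ℕ}

/-- Primitive recursion on the natural numbers. -/
def primrec (a : ℕ) (h : ℕ → ℕ → ℕ) : ℕ → ℕ
  | 0 => a
  | i + 1 => h i (primrec a h i)

/-- The loop `for x = 0, …, y - 1 do b[x] := c` where `y` is the variable `x + 1` and `c` leaves its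
result in the variable `x + 2`. -/
def fillRow (x b : ℕ) (c : Cmd) : Cmd :=
  forLoop x (x + 1) (.seq c (.store b (.var x) (.var (x + 2))))

/-- The array `b` is exempt from the assumptions on the starting state of the body, since it is
partly overwritten when the body runs. -/
theorem Halts.fillRow {x b G L T : ℕ} {c : Cmd} {W : ℕ → ℕ} {σ : State} (hb : b < L)
    (hG : σ.vars (x + 1) = G)
    (hc : ∀ τ, ∀ i < G, (∀ y < x, τ.vars y = σ.vars y) →
      (∀ a < L, a ≠ b → τ.arrs a = σ.arrs a) → τ.vars x = i →
      Halts c τ T fun φ => Frame (x + 2) L τ φ ∧ φ.vars (x + 2) = W i) :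
    Halts (RAM.fillRow x b c) σ (G * (T + 11) + 6) fun τ =>
      (∀ y < x, τ.vars y = σ.vars y) ∧ (∀ a < L, a ≠ b → τ.arrs a = σ.arrs a) ∧
      τ.vars (x + 1) = G ∧ ∀ i < G, τ.arrs b i = W i := by
  refine Halts.forLoop (T := T + 3) (fun i τ =>
    (∀ y < x, τ.vars y = σ.vars y) ∧ (∀ a < L, a ≠ b → τ.arrs a = σ.arrs a) ∧
      τ.vars (x + 1) = G ∧ ∀ j < i, τ.arrs b j = W j) (by omega) ?_ ?_ hG
  · rintro i hi τ ⟨h1, h2, -, h3⟩ hx hy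
    refine Halts.seq ((hc τ i hi h1 h2 hx).mono le_rfl ?_)
    rintro φ ⟨h4, h5⟩
    refine Halts.store (i := .var x) (e := .var (x + 2)) ⟨?_, ?_, ?_, ?_, ?_, ?_⟩
    · rw [State.put_vars, h4.1 _ (by omega), hx]
    · rw [State.put_vars, h4.1 _ (by omega), hy]
    · intro y hy
      rw [State.set_vars_ne _ (by omega), State.put_vars, h4.1 _ (by omega), h1 y hy]
    · intro y hy hne
      rw [State.set_arrs, State.put_arrs_ne _ hne, h4.2 _ hy, h2 y hy hne]
    · rw [State.set_vars_ne _ (by omega), State.put_vars, h4.1 _ (by omega), hy]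
    · intro j hj
      simp only [State.set_arrs, Expr.eval]
      rw [State.put_arrs_self, h4.1 x (by omega), hx, h5, h4.2 b hb]
      split_ifs with hji
      · rw [hji]
      · exact h3 j (by omega)
  · refine ⟨fun y hy => State.set_vars_ne _ (by omega), fun _ _ _ => rfl, ?_, by simp⟩
    rw [State.set_vars_ne _ (by omega), hG]

namespace PT

variable {m : ℕ}

/-- The minimum is expressed by truncated subtraction, as `e - (e - B)`. -/
theorem minBd {B : ι → ℕ} (hB : Bd enc B) {e : ι → (ℕ → ℕ) → (Fin m → ℕ) → ℕ}
    (he : PT enc e) : PT enc fun I A v => min (e I A v) (B I) :=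
  (he.sub (he.sub hB.pt)).congr fun _ _ _ => by omega

/-- Recursion with polynomially many steps, `e` in number. -/
theorem fold {B : ι → ℕ} (hB : Bd enc B) {e f : ι → (ℕ → ℕ) → (Fin m → ℕ) → ℕ}
    {h : ι → (ℕ → ℕ) → (Fin m → ℕ) → ℕ → ℕ → ℕ} (he : PT enc e) (hf : PT enc f)
    (hh : PT enc fun I A (w : Fin (m + 2) → ℕ) =>
      h I A (fun j => w j.succ.succ) (w (Fin.succ 0)) (w 0)) :
    PT enc fun I A v => primrec (f I A v) (h I A v) (min (e I A v) (B I)) := by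
  intro o ρ d a hρ ho ha
  obtain ⟨c1, p1, h1⟩ := (minBd hB he) o ρ (d + 2) a (fun j => (hρ j).trans (by omega)) ho ha
  obtain ⟨c2, p2, h2⟩ := hf o ρ (d + 3) a (fun j => (hρ j).trans (by omega)) ho ha
  obtain ⟨c3, p3, h3⟩ := hh o (Fin.cons d (Fin.cons (d + 1) ρ)) (d + 3) a
    (fun j => by
      refine Fin.cases ?_ (fun j => ?_) j
      · exact Nat.lt_add_of_pos_right (by omega)
      · refine Fin.cases ?_ (fun j => ?_) j
        · exact Nat.add_lt_add_left (by omega) d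
        · exact (hρ j).trans (Nat.lt_add_of_pos_right (by omega))) ho ha
  obtain ⟨q, hq⟩ := hB.2
  -- Register `d` is the accumulator, `d + 1` the counter, `d + 2` the number of rounds and `d + 3`
  -- the scratch result of a step.
  refine ⟨.seq c1 (.seq c2 (.seq (.assign d (.var (d + 3)))
    (forLoop (d + 1) (d + 2) (.seq c3 (.assign d (.var (d + 3))))))),
    p1 + (p2 + (Polynomial.C 2 + (q * (p3 + Polynomial.C 2 + Polynomial.C 8) + Polynomial.C 6))),
    fun I σ hI => ?_⟩
  simp only [Polynomial.eval_add, Polynomial.eval_mul, Polynomial.eval_C]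
  refine Halts.seq ((h1 I σ hI).mono le_rfl ?_)
  rintro τ ⟨ha1, ha2⟩
  refine Halts.seq ((h2 I τ (hI.frame ha ha1)).mono le_rfl ?_)
  rintro υ ⟨hb1, hb2⟩
  have hfr : Frame (d + 2) a σ υ := ha1.trans (hb1.mono (by omega) le_rfl)
  refine Halts.seq (T := 2) (Halts.assign ?_)
  have e1 : ∀ {τ}, Frame d a σ τ → (fun j => τ.vars (ρ j)) = fun j => σ.vars (ρ j) :=
    fun h => funext fun j => h.1 _ (hρ j)
  rw [e1 (ha1.mono (by omega) le_rfl), ha1.2 o ho] at hb2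
  have hy : (υ.set d ((Expr.var (d + 3)).eval υ)).vars (d + 2)
      = min (e I (σ.arrs o) fun j => σ.vars (ρ j)) (B I) := by
    rw [State.set_vars_ne _ (by omega), hb1.1 _ (by omega), ha2]
  refine (Halts.forLoop (fun i τ => Frame d a σ τ ∧
    τ.vars d = primrec (f I (σ.arrs o) fun j => σ.vars (ρ j))
      (h I (σ.arrs o) fun j => σ.vars (ρ j)) i)
    (T := p3.eval (bitLength (enc I)) + 2) (by omega) ?_ ?_ hy).mono
    (Nat.add_le_add_right (Nat.mul_le_mul_right _ ((min_le_right _ _).trans (hq I))) _)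
    fun _ => id
  · rintro i hi τ ⟨hc1, hc2⟩ hx hy
    refine Halts.seq ((h3 I τ (hI.frame ha hc1)).mono le_rfl ?_)
    rintro φ ⟨hd1, hd2⟩
    refine Halts.assign ⟨?_, ?_, ?_, ?_⟩
    · rw [State.set_vars_ne _ (by omega), hd1.1 _ (by omega), hx]
    · rw [State.set_vars_ne _ (by omega), hd1.1 _ (by omega), hy]
    · exact ((hc1.trans (hd1.mono (by omega) le_rfl)).set le_rfl _).set (by omega) _
    · rw [State.set_vars_ne _ (by omega), State.set_vars_self]
      simp only [Expr.eval]
      rw [hd2, hc1.2 o ho]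
      simp only [Fin.cons_succ, Fin.cons_zero, hx, hc2]
      rw [e1 hc1]
      rfl
  · refine ⟨((hfr.mono (by omega) le_rfl).set le_rfl _).set (by omega) _, ?_⟩
    rw [State.set_vars_ne _ (by omega), State.set_vars_self]
    exact hb2

/-- Recursion where each step computes a row of polynomially many numbers from the row before,
which is given by the oracle. -/
theorem iter {g B : ι → ℕ} (hg : Bd enc g) (hB : Bd enc B)
    {Row : ι → (Fin m → ℕ) → ℕ → ℕ → ℕ} {H : ι → (ℕ → ℕ) → (Fin m → ℕ) → ℕ → ℕ → ℕ}
    (h0 : PT enc fun I _ (w : Fin (m + 1) → ℕ) => Row I (fun j => w j.succ) 0 (w 0))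
    (hH : PT enc fun I A (w : Fin (m + 2) → ℕ) =>
      H I A (fun j => w j.succ.succ) (w (Fin.succ 0)) (w 0))
    (hR : ∀ I v i x A, x < g I → (∀ y < g I, A y = Row I v i y) →
      H I A v i x = Row I v (i + 1) x)
    {e x : ι → (ℕ → ℕ) → (Fin m → ℕ) → ℕ} (he : PT enc e) (hx : PT enc x) :
    PT enc fun I A v => if x I A v < g I then Row I v (min (e I A v) (B I)) (x I A v) else 0 := by
  intro o ρ d a hρ ho ha
  obtain ⟨c1, p1, h1⟩ := (minBd hB he) o ρ (d + 2) a (fun j => (hρ j).trans (by omega)) ho ha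
  obtain ⟨c2, p2, h2⟩ := hg.1 o Fin.elim0 (d + 4) a (fun j => j.elim0) ho ha
  obtain ⟨c3, p3, h3⟩ := h0 o (Fin.cons (d + 3) ρ) (d + 5) (a + 2)
    (fun j => by
      refine Fin.cases ?_ (fun j => ?_) j
      · exact Nat.add_lt_add_left (by omega) d
      · exact (hρ j).trans (Nat.lt_add_of_pos_right (by omega))) (by omega) (by omega)
  obtain ⟨c4, p4, h4⟩ := hH a (Fin.cons (d + 3) (Fin.cons (d + 1) ρ)) (d + 5) (a + 2)
    (fun j => by
      refine Fin.cases ?_ (fun j => ?_) j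
      · exact Nat.add_lt_add_left (by omega) d
      · refine Fin.cases ?_ (fun j => ?_) j
        · exact Nat.add_lt_add_left (by omega) d
        · exact (hρ j).trans (Nat.lt_add_of_pos_right (by omega))) (by omega) (by omega)
  obtain ⟨c5, p5, h5⟩ := hx o ρ (d + 5) (a + 1) (fun j => (hρ j).trans (by omega)) (by omega) (by omega)
  obtain ⟨q, hq⟩ := hB.2
  obtain ⟨r, hr⟩ := hg.2
  -- Array `a` holds the current row and serves as the oracle. The next row is written to `a + 1`
  -- and then copied back, since each of its entries may depend on the whole old row. Registers from
  -- `d + 1` on: round, number of rounds, column, row length, computed entry.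
  refine ⟨.seq c1 (.seq c2 (.seq
    (fillRow (d + 3) a c3) (.seq
    (forLoop (d + 1) (d + 2) (.seq (fillRow (d + 3) (a + 1) c4)
      (fillRow (d + 3) a (.assign (d + 5) (.get (a + 1) (.var (d + 3))))))) (.seq
    c5 (.ite (.sub (.var (d + 4)) (.var (d + 5))) (.assign d (.get a (.var (d + 5))))
      (.assign d (.const 0))))))),
    p1 + (p2 + ((r * (p3 + Polynomial.C 11) + Polynomial.C 6) + ((q * (((r * (p4 + Polynomial.C 11)
      + Polynomial.C 6) + (r * (Polynomial.C 3 + Polynomial.C 11) + Polynomial.C 6)) +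
      Polynomial.C 8) + Polynomial.C 6) + (p5 + (Polynomial.C 4 + Polynomial.C 3))))),
    fun I σ hI => ?_⟩
  simp only [Polynomial.eval_add, Polynomial.eval_mul, Polynomial.eval_C]
  have e1 : ∀ {τ}, Frame d a σ τ → (fun j => τ.vars (ρ j)) = fun j => σ.vars (ρ j) :=
    fun h => funext fun j => h.1 _ (hρ j)
  set v : Fin m → ℕ := fun j => σ.vars (ρ j) with hv
  set E := min (e I (σ.arrs o) v) (B I) with hE
  refine Halts.seq ((h1 I σ hI).mono le_rfl ?_)
  rintro τ ⟨ha1, ha2⟩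
  refine Halts.seq ((h2 I τ (hI.frame ha ha1)).mono le_rfl ?_)
  rintro υ ⟨hb1, hb2⟩
  have hf1 : Frame d a σ υ := (ha1.mono (by omega) le_rfl).trans (hb1.mono (by omega) le_rfl)
  have hu : υ.vars (d + 2) = E := by rw [hb1.1 _ (by omega), ha2]
  refine Halts.seq ((Halts.fillRow (W := Row I v 0) (L := a + 2) (by omega) hb2 ?_).mono
    (Nat.add_le_add_right (Nat.mul_le_mul_right _ (hr I)) _) ?_)
  · rintro τ x hx hc1 hc2 hc3
    have hf2 : Frame d a σ τ := hf1.trans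
      ⟨fun y hy => hc1 y (by omega), fun y hy => hc2 y (by omega) (by omega)⟩
    refine (h3 I τ (hI.frame ha hf2)).mono le_rfl fun φ hφ => ⟨hφ.1, ?_⟩
    rw [hφ.2]
    simp only [Fin.cons_succ, Fin.cons_zero, hc3]
    rw [e1 hf2]
  rintro τ ⟨hc1, hc2, hc3, hc4⟩
  have hf2 : Frame d a σ τ := hf1.trans
    ⟨fun y hy => hc1 y (by omega), fun y hy => hc2 y (by omega) (by omega)⟩
  refine Halts.seq ((Halts.forLoop (B := E) (fun i τ => Frame d a σ τ ∧ τ.vars (d + 4) = g I ∧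
    ∀ y < g I, τ.arrs a y = Row I v i y) (by omega) ?_ ?_ ?_).mono
    (Nat.add_le_add_right (Nat.mul_le_mul_right _ ((min_le_right _ _).trans (hq I))) _) ?_)
  · rintro i hi φ ⟨hd1, hd2, hd3⟩ hi1 hi2
    refine Halts.seq ((Halts.fillRow (W := Row I v (i + 1)) (L := a + 2) (by omega) hd2 ?_).mono
      (Nat.add_le_add_right (Nat.mul_le_mul_right _ (hr I)) _) ?_)
    · rintro ψ x hx he1 he2 he3
      have hf3 : Frame d a σ ψ := hd1.trans
        ⟨fun y hy => he1 y (by omega), fun y hy => he2 y (by omega) (by omega)⟩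
      refine (h4 I ψ (hI.frame ha hf3)).mono le_rfl fun χ hχ => ⟨hχ.1, ?_⟩
      rw [hχ.2, he2 a (by omega) (by omega)]
      simp only [Fin.cons_succ, Fin.cons_zero, he3, he1 (d + 1) (by omega), hi1]
      rw [e1 hf3]
      exact hR I v i x _ hx hd3
    rintro ψ ⟨he1, he2, he3, he4⟩
    refine (Halts.fillRow (W := Row I v (i + 1)) (L := a + 2) (T := 3) (by omega) he3 ?_).mono
      (Nat.add_le_add_right (Nat.mul_le_mul_right _ (hr I)) _) ?_
    · rintro χ x hx hg1 hg2 hg3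
      refine Halts.assign (e := .get (a + 1) (.var (d + 3)))
        ⟨(Frame.refl _ _ _).set le_rfl _, ?_⟩
      rw [State.set_vars_self]
      simp only [Expr.eval]
      rw [hg3, hg2 _ (by omega) (by omega), he4 x hx]
    rintro χ ⟨hg1, hg2, hg3, hg4⟩
    refine ⟨?_, ?_, ?_, ?_, ?_⟩
    · rw [hg1 _ (by omega), he1 _ (by omega), hi1]
    · rw [hg1 _ (by omega), he1 _ (by omega), hi2]
    · refine (hd1.trans ⟨fun y hy => ?_, fun y hy => ?_⟩).set (by omega) _
      · rw [hg1 _ (by omega), he1 _ (by omega)]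
      · rw [hg2 _ (by omega) (by omega), he2 _ (by omega) (by omega)]
    · rw [State.set_vars_ne _ (by omega), hg3]
    · exact hg4
  · refine ⟨hf2.set (by omega) _, ?_, hc4⟩
    rw [State.set_vars_ne _ (by omega), hc3]
  · rw [hc1 _ (by omega), hu]
  rintro φ ⟨hd1, hd2, hd3⟩
  refine Halts.seq ((h5 I φ (hI.frame ha hd1)).mono le_rfl ?_)
  rintro ψ ⟨he1, he2⟩
  rw [e1 hd1, hd1.2 o ho] at he2
  have hf3 : Frame d a σ ψ := hd1.trans (he1.mono (by omega) (by omega))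
  -- Cells of `a` from `g I` on are not controlled, so an index out of range is answered by `0`.
  refine Halts.ite (e := .sub (.var (d + 4)) (.var (d + 5))) (fun hne => ?_) fun heq => ?_
  · simp only [Expr.eval] at hne
    rw [he1.1 _ (by omega), hd2, he2] at hne
    refine Halts.assign ⟨hf3.set le_rfl _, ?_⟩
    rw [State.set_vars_self, if_pos (by omega)]
    simp only [Expr.eval]
    rw [he1.2 a (by omega), he2, hd3 _ (by omega)]
  · simp only [Expr.eval] at heq
    rw [he1.1 _ (by omega), hd2, he2] at heq
    refine (Halts.assign (e := .const 0) ⟨hf3.set le_rfl _, ?_⟩).mono (by simp [Expr.cost])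
      fun _ => id
    rw [State.set_vars_self, if_neg (by omega)]
    rfl

end PT
end RAM

/-! ### Polynomial bounds, sums, maxima and decidable properties -/

namespace RAM

variable {ι : Type} {enc : ι → List ℕ}

theorem Bd.const (c : ℕ) : Bd enc fun _ => c :=
  ⟨PT.const c, Polynomial.C c, fun I => by simp⟩

theorem Bd.add {B C : ι → ℕ} (hB : Bd enc B) (hC : Bd enc C) : Bd enc fun I => B I + C I := by
  obtain ⟨hB, p, hp⟩ := hB
  obtain ⟨hC, q, hq⟩ := hC
  exact ⟨hB.add hC, p + q, fun I => by
    rw [Polynomial.eval_add]; exact Nat.add_le_add (hp I) (hq I)⟩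

namespace PT

variable {m : ℕ} {B : ι → ℕ}

/-- Without a multiplication instruction, a product is a repeated addition, so one factor must be
polynomially bounded. -/
theorem mulBd (hB : Bd enc B) {f : ι → (ℕ → ℕ) → (Fin m → ℕ) → ℕ} (hf : PT enc f) :
    PT enc fun I A v => B I * f I A v := by
  refine (fold hB (e := fun I _ _ => B I) (f := fun _ _ _ => 0)
    (h := fun I A v _ acc => acc + f I A v) hB.pt (const 0)
    ((var 0).add (hf.reindex fun j => j.succ.succ))).congr fun I A v => ?_
  rw [min_self]
  induction B I with
  | zero => simp [primrec]
  | succ n ih => rw [primrec, ← ih]; ring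

theorem sum (hB : Bd enc B) {f : ι → (ℕ → ℕ) → (Fin m → ℕ) → ℕ → ℕ}
    (hf : PT enc fun I A (w : Fin (m + 1) → ℕ) => f I A (fun j => w j.succ) (w 0)) :
    PT enc fun I A v => ∑ i ∈ Finset.range (B I), f I A v i := by
  refine (fold hB (e := fun I _ _ => B I) (f := fun _ _ _ => 0)
    (h := fun I A v i acc => acc + f I A v i) hB.pt (const 0)
    ((var 0).add (hf.reindex Fin.succ))).congr fun I A v => ?_
  rw [min_self]
  induction B I with
  | zero => simp [primrec]
  | succ n ih => rw [primrec, ← ih, Finset.sum_range_succ]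

theorem sup (hB : Bd enc B) {f : ι → (ℕ → ℕ) → (Fin m → ℕ) → ℕ → ℕ}
    (hf : PT enc fun I A (w : Fin (m + 1) → ℕ) => f I A (fun j => w j.succ) (w 0)) :
    PT enc fun I A v => (Finset.range (B I)).sup (f I A v) := by
  -- With truncated subtraction, `acc + (x - acc)` is the maximum of `acc` and `x`.
  refine (fold hB (e := fun I _ _ => B I) (f := fun _ _ _ => 0)
    (h := fun I A v i acc => acc + (f I A v i - acc)) hB.pt (const 0)
    ((var 0).add ((hf.reindex Fin.succ).sub (var 0)))).congr fun I A v => ?_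
  rw [min_self]
  induction B I with
  | zero => simp [primrec]
  | succ n ih =>
    rw [primrec, ← ih, Finset.range_add_one, Finset.sup_insert]
    omega

end PT

theorem Bd.mul {B C : ι → ℕ} (hB : Bd enc B) (hC : Bd enc C) : Bd enc fun I => B I * C I := by
  refine ⟨PT.mulBd hB hC.1, ?_⟩
  obtain ⟨-, p, hp⟩ := hB
  obtain ⟨-, q, hq⟩ := hC
  exact ⟨p * q, fun I => by
    rw [Polynomial.eval_mul]; exact Nat.mul_le_mul (hp I) (hq I)⟩

theorem Bd.pow {B : ι → ℕ} (hB : Bd enc B) (k : ℕ) : Bd enc fun I => B I ^ k := by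
  induction k with
  | zero => simpa using Bd.const 1
  | succ k ih => simpa [pow_succ] using ih.mul hB

/-- A property which can be decided in polynomial time, in the sense of `PT`. -/
def PP (enc : ι → List ℕ) {m : ℕ} (P : ι → (ℕ → ℕ) → (Fin m → ℕ) → Prop) : Prop :=
  ∃ f : ι → (ℕ → ℕ) → (Fin m → ℕ) → ℕ, PT enc f ∧ ∀ I A v, f I A v ≠ 0 ↔ P I A v

theorem PT.ite {m : ℕ} {P : ι → (ℕ → ℕ) → (Fin m → ℕ) → Prop} (hP : PP enc P)
    {f g : ι → (ℕ → ℕ) → (Fin m → ℕ) → ℕ} (hf : PT enc f) (hg : PT enc g)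
    [∀ I A v, Decidable (P I A v)] :
    PT enc fun I A v => if P I A v then f I A v else g I A v := by
  obtain ⟨c, hc, h⟩ := hP
  refine (hc.cond hf hg).congr fun I A v => ?_
  by_cases h0 : c I A v = 0
  · rw [if_pos h0, if_neg fun h1 => (h I A v).2 h1 h0]
  · rw [if_neg h0, if_pos ((h I A v).1 h0)]

namespace PP

variable {m : ℕ} {P Q : ι → (ℕ → ℕ) → (Fin m → ℕ) → Prop}
  {f g : ι → (ℕ → ℕ) → (Fin m → ℕ) → ℕ}

theorem congr (hP : PP enc P) (h : ∀ I A v, Q I A v ↔ P I A v) : PP enc Q := by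
  have : Q = P := by funext I A v; exact propext (h I A v)
  rwa [this]

theorem ne_zero (hf : PT enc f) : PP enc fun I A v => f I A v ≠ 0 :=
  ⟨f, hf, fun _ _ _ => Iff.rfl⟩

theorem lt (hf : PT enc f) (hg : PT enc g) : PP enc fun I A v => f I A v < g I A v :=
  (ne_zero (hg.sub hf)).congr fun _ _ _ => by omega

theorem le (hf : PT enc f) (hg : PT enc g) : PP enc fun I A v => f I A v ≤ g I A v :=
  (lt hf (hg.add (.const 1))).congr fun _ _ _ => by omega

theorem not (hP : PP enc P) : PP enc fun I A v => ¬ P I A v := by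
  obtain ⟨f, hf, h⟩ := hP
  exact (le hf (.const 0)).congr fun I A v => by rw [← h]; omega

theorem and (hP : PP enc P) (hQ : PP enc Q) : PP enc fun I A v => P I A v ∧ Q I A v := by
  obtain ⟨f, hf, h⟩ := hP
  obtain ⟨g, hg, h'⟩ := hQ
  refine (ne_zero (hf.cond hg (.const 0))).congr fun I A v => ?_
  rw [← h, ← h']
  split_ifs with h0 <;> simp [h0]

theorem or (hP : PP enc P) (hQ : PP enc Q) : PP enc fun I A v => P I A v ∨ Q I A v :=
  (hP.not.and hQ.not).not.congr fun I A v => by tauto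

theorem imp (hP : PP enc P) (hQ : PP enc Q) : PP enc fun I A v => P I A v → Q I A v :=
  (hP.not.or hQ).congr fun I A v => by tauto

theorem eq (hf : PT enc f) (hg : PT enc g) : PP enc fun I A v => f I A v = g I A v :=
  ((le hf hg).and (le hg hf)).congr fun _ _ _ => by omega

theorem ex {B : ι → ℕ} (hB : Bd enc B) {P : ι → (ℕ → ℕ) → (Fin m → ℕ) → ℕ → Prop}
    (hP : PP enc fun I A (w : Fin (m + 1) → ℕ) => P I A (fun j => w j.succ) (w 0)) :
    PP enc fun I A v => ∃ i < B I, P I A v i := by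
  classical
  have hs := PT.sum hB (f := fun I A v i => if P I A v i then 1 else 0)
    (PT.ite hP (.const 1) (.const 0))
  refine (ne_zero hs).congr fun I A v => ?_
  simp

theorem all {B : ι → ℕ} (hB : Bd enc B) {P : ι → (ℕ → ℕ) → (Fin m → ℕ) → ℕ → Prop}
    (hP : PP enc fun I A (w : Fin (m + 1) → ℕ) => P I A (fun j => w j.succ) (w 0)) :
    PP enc fun I A v => ∀ i < B I, P I A v i :=
  (ex hB (P := fun I A v i => ¬ P I A v i) hP.not).not.congr fun I A v => by push Not; rfl

theorem comp₂ {F : ι → ℕ → ℕ → Prop} (hF : PP enc (m := 2) fun I _ v => F I (v 0) (v 1))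
    (hf : PT enc f) (hg : PT enc g) : PP enc fun I A v => F I (f I A v) (g I A v) := by
  classical
  have : PT enc (m := 2) fun I _ v => if F I (v 0) (v 1) then 1 else 0 :=
    .ite hF (.const 1) (.const 0)
  refine (ne_zero (PT.comp₂ (F := fun I x y => if F I x y then 1 else 0) this hf hg)).congr ?_
  simp

theorem comp₃ {F : ι → ℕ → ℕ → ℕ → Prop}
    (hF : PP enc (m := 3) fun I _ v => F I (v 0) (v 1) (v 2))
    {h : ι → (ℕ → ℕ) → (Fin m → ℕ) → ℕ}
    (hf : PT enc f) (hg : PT enc g) (hh : PT enc h) :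
    PP enc fun I A v => F I (f I A v) (g I A v) (h I A v) := by
  classical
  have : PT enc (m := 3) fun I _ v => if F I (v 0) (v 1) (v 2) then 1 else 0 :=
    .ite hF (.const 1) (.const 0)
  refine (ne_zero
    (PT.comp₃ (F := fun I x y z => if F I x y z then 1 else 0) this hf hg hh)).congr ?_
  simp

end PP

open Classical in
/-- The greatest `i < n` with the property `P`, if there is one, and `0` otherwise. -/
noncomputable def lastSat (n : ℕ) (P : ℕ → Prop) : ℕ :=
  primrec 0 (fun i acc => if P i then i else acc) n

theorem lastSat_spec {n : ℕ} {P : ℕ → Prop} (h : ∃ i < n, P i) :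
    lastSat n P < n ∧ P (lastSat n P) := by
  induction n with
  | zero => simp at h
  | succ n ih =>
    rw [lastSat, primrec]
    split_ifs with hP
    · exact ⟨by omega, hP⟩
    · obtain ⟨i, hi, hPi⟩ := h
      have := ih ⟨i, by
        rcases Nat.lt_succ_iff_lt_or_eq.1 hi with h | rfl
        · exact h
        · exact absurd hPi hP, hPi⟩
      exact ⟨this.1.trans (by omega), this.2⟩

theorem PT.lastSat {m : ℕ} {B : ι → ℕ} (hB : Bd enc B)
    {P : ι → (ℕ → ℕ) → (Fin m → ℕ) → ℕ → Prop}
    (hP : PP enc fun I A (w : Fin (m + 1) → ℕ) => P I A (fun j => w j.succ) (w 0)) :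
    PT enc fun I A v => RAM.lastSat (B I) (P I A v) := by
  classical
  obtain ⟨f, hf, h⟩ := hP
  have h' : PP enc fun I A (w : Fin (m + 2) → ℕ) =>
    P I A (fun j => w j.succ.succ) (w (Fin.succ 0)) :=
    ⟨_, hf.reindex Fin.succ, fun I A v => h I A _⟩
  refine (PT.fold hB (e := fun I _ _ => B I) (f := fun _ _ _ => 0)
    (h := fun I A v i acc => if P I A v i then i else acc) hB.pt (.const 0)
    (PT.ite h' (.var _) (.var _))).congr fun I A v => ?_
  rw [min_self]
  unfold RAM.lastSat
  congr!

/-! ### Printing the answer -/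

theorem State.output_push {σ τ : State} {x : ℕ} (h1 : τ.vars 1 = σ.vars 1 + 1)
    (h2 : ∀ i < σ.vars 1, τ.arrs 1 i = σ.arrs 1 i) (h3 : τ.arrs 1 (σ.vars 1) = x) :
    τ.output = σ.output ++ [x] := by
  rw [State.output, h1, List.range_succ, List.map_append, List.map_singleton, h3, State.output]
  congr 1
  exact List.map_congr_left fun i hi => h2 i (List.mem_range.1 hi)

/-- The command which prints the value of `e`. -/
def push (e : Expr) : Cmd :=
  .seq (.store 1 (.var 1) e) (.assign 1 (.add (.var 1) (.const 1)))

theorem Halts.push {e : Expr} {σ : State} {Q : State → Prop}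
    (h : ∀ τ : State, τ.output = σ.output ++ [e.eval σ] → (∀ x ≠ 1, τ.vars x = σ.vars x) →
      (∀ a ≠ 1, τ.arrs a = σ.arrs a) → Q τ) :
    Halts (RAM.push e) σ (e.cost + 6) Q := by
  have hQ : Q ((σ.put 1 (σ.vars 1) (e.eval σ)).set 1 (σ.vars 1 + 1)) := by
    refine h _ (State.output_push ?_ ?_ ?_) ?_ ?_
    · simp
    · intro i hi
      rw [State.set_arrs, State.put_arrs_self, if_neg hi.ne]
    · rw [State.set_arrs, State.put_arrs_self, if_pos rfl]
    · intro x hx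
      rw [State.set_vars_ne _ hx, State.put_vars]
    · intro a ha
      rw [State.set_arrs, State.put_arrs_ne _ ha]
  refine (Halts.seq (Halts.store (Halts.assign ?_))).mono (by simp [Expr.cost]; omega) fun _ => id
  simpa [Expr.eval] using hQ

/-- A search problem is solvable in polynomial time if it has a solution which is the list of all
`i` below a polynomial bound with a property decidable in polynomial time, where each `i` is
followed by a number computable in polynomial time. -/
theorem solvable_of_list {R : ι → List ℕ → Prop} {B : ι → ℕ} {P : ι → ℕ → Prop}
    [∀ I i, Decidable (P I i)] {g : ι → ℕ → ℕ} (hB : Bd enc B)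
    (hP : PP enc (m := 1) fun I _ v => P I (v 0)) (hg : PT enc (m := 1) fun I _ v => g I (v 0))
    (h : ∀ I, R I ((List.range (B I)).flatMap fun i => if P I i then [i, g I i] else [])) :
    SolvableInPolyTime enc R := by
  obtain ⟨f, hf, hfP⟩ := hP
  -- Variable `1` and array `1` belong to the output, so working registers start at `2` and arrays
  -- below `3` are kept intact; array `2` is a dummy oracle.
  obtain ⟨c1, p1, h1⟩ := hB.1 2 Fin.elim0 3 3 (fun j => j.elim0) (by omega) (by omega)
  obtain ⟨c2, p2, h2⟩ := hf 2 (fun _ => 2) 4 3 (fun j => by omega) (by omega) (by omega)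
  obtain ⟨c3, p3, h3⟩ := hg 2 (fun _ => 2) 5 3 (fun j => by omega) (by omega) (by omega)
  obtain ⟨q, hq⟩ := hB.2
  refine ⟨.seq c1 (forLoop 2 3 (.seq c2 (.seq c3 (.ite (.var 4)
    (.seq (push (.var 2)) (push (.var 5))) .skip)))),
    p1 + (q * (p2 + (p3 + Polynomial.C 16) + Polynomial.C 8) + Polynomial.C 6)
      + Polynomial.C 2 * q, fun I => ?_⟩
  simp only [Polynomial.eval_add, Polynomial.eval_mul, Polynomial.eval_C]
  have key : Halts (.seq c1 (forLoop 2 3 (.seq c2 (.seq c3 (.ite (.var 4)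
      (.seq (push (.var 2)) (push (.var 5))) .skip))))) (initState (enc I))
      (p1.eval (bitLength (enc I)) + (q.eval (bitLength (enc I)) *
        (p2.eval (bitLength (enc I)) + (p3.eval (bitLength (enc I)) + 16) + 8) + 6))
      fun τ => Inp enc I τ ∧ τ.output =
        (List.range (B I)).flatMap fun i => if P I i then [i, g I i] else [] := by
    refine Halts.seq ((h1 I _ (by funext i; simp [initState])).mono le_rfl ?_)
    rintro τ ⟨ha1, ha2⟩
    refine (Halts.forLoop (fun i τ => Inp enc I τ ∧ τ.output =
      (List.range i).flatMap fun i => if P I i then [i, g I i] else [])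
      (by omega) ?_ ?_ ha2).mono
      (Nat.add_le_add_right (Nat.mul_le_mul_right _ (hq I)) _) fun _ => id
    · rintro i hi σ ⟨hb1, hb2⟩ hx hy
      refine Halts.seq ((h2 I σ hb1).mono le_rfl ?_)
      rintro υ ⟨hc1, hc2⟩
      refine Halts.seq ((h3 I υ (hb1.frame (by omega) hc1)).mono le_rfl ?_)
      rintro φ ⟨hd1, hd2⟩
      rw [hx] at hc2
      rw [hc1.1 2 (by omega), hx] at hd2
      have hd3 : φ.vars 4 = f I (σ.arrs 2) fun _ => i := by rw [hd1.1 4 (by omega), hc2]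
      have hx' : φ.vars 2 = i := by rw [hd1.1 2 (by omega), hc1.1 2 (by omega), hx]
      have hy' : φ.vars 3 = B I := by rw [hd1.1 3 (by omega), hc1.1 3 (by omega), hy]
      have hout : φ.output = σ.output := by
        rw [State.output, hd1.1 1 (by omega), hc1.1 1 (by omega), hd1.2 1 (by omega),
          hc1.2 1 (by omega), State.output]
      have hin : Inp enc I φ := (hb1.frame (by omega) hc1).frame (by omega) hd1
      rw [List.range_succ, List.flatMap_append, List.flatMap_singleton]
      have hset : ∀ τ : State, (τ.set 2 (i + 1)).output = τ.output := fun τ => by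
        rw [State.output, State.set_vars_ne _ (by omega), State.set_arrs, State.output]
      refine (Halts.ite (e := .var 4) (T := 14) (fun hne => ?_) fun heq => ?_).mono
        (by simp [Expr.cost]) fun _ => id
      · simp only [Expr.eval] at hne
        rw [hd3, hfP] at hne
        rw [if_pos hne]
        refine Halts.seq (T := 7) (U := 7) (Halts.push fun ψ hψ1 hψ2 hψ3 =>
          Halts.push fun χ hχ1 hχ2 hχ3 => ⟨?_, ?_, ?_, ?_⟩)
        · rw [hχ2 _ (by omega), hψ2 _ (by omega), hx']
        · rw [hχ2 _ (by omega), hψ2 _ (by omega), hy']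
        · exact ((hχ3 0 (by omega)).trans (hψ3 0 (by omega))).trans hin
        · rw [hset, hχ1, hψ1, hout, hb2]
          simp only [Expr.eval]
          rw [hψ2 5 (by omega), hd2, hx', List.append_assoc]
          rfl
      · simp only [Expr.eval] at heq
        rw [hd3] at heq
        rw [if_neg fun h => (hfP I _ _).2 h heq, List.append_nil]
        refine (Halts.skip ⟨hx', hy', hin, ?_⟩).mono (by omega) fun _ => id
        rw [hset, hout, hb2]
    · refine ⟨?_, ?_⟩
      · rw [Inp, State.set_arrs, ha1.2 0 (by omega)]
        funext i
        simp [initState]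
      · rw [State.output, State.set_vars_ne _ (by omega), ha1.1 1 (by omega)]
        simp [initState]
  obtain ⟨t, τ, h4, h5, -, h7⟩ := key
  refine ⟨t, τ, h4, Nat.add_le_add h5 ?_, h7 ▸ h I⟩
  rw [h7, List.length_flatMap]
  refine (List.sum_le_card_nsmul _ 2 ?_).trans ?_
  · intro x hx
    obtain ⟨i, -, rfl⟩ := List.mem_map.1 hx
    split_ifs <;> simp
  · rw [List.length_map, List.length_range, smul_eq_mul, mul_comm]
    exact Nat.mul_le_mul_left 2 (hq I)

end RAM

namespace RAM

/-! ### Optimal paths in a layered graph -/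

section Layered

variable (rel : ℕ → ℕ → ℕ → Prop) (gain : ℕ → ℕ → ℕ) (L M : ℕ)

open Classical in
/-- The greatest total gain on the last `r` of `L` stages, starting from the node `x`; the nodes
are the numbers below `M`. -/
noncomputable def bestGain : ℕ → ℕ → ℕ
  | 0, _ => 0
  | r + 1, x => (Finset.range M).sup fun y =>
      if rel (L - 1 - r) x y then gain (L - 1 - r) y + bestGain r y else 0

/-- `bestGain` on nodes, extended by `0` to all numbers. -/
noncomputable def bestGainNode (r x : ℕ) : ℕ :=
  if x < M then bestGain rel gain L M (min r L) x else 0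

/-- The node after `x` on an optimal path, at stage `i`. -/
noncomputable def nextNode (i x : ℕ) : ℕ :=
  lastSat M fun y => rel i x y ∧ bestGainNode rel gain L M (L - i) x =
    gain i y + bestGainNode rel gain L M (L - 1 - i) y

/-- An optimal path which starts at the node `0`. -/
noncomputable def bestPath : ℕ → ℕ := primrec 0 (nextNode rel gain L M)

variable {rel gain L M}

/-- Node `0` may follow every node, so no node is a dead end and the best gain is always realised by
an actual successor. -/
theorem nextNode_spec (hM : 0 < M) (h0 : ∀ i x, rel i x 0) {i x : ℕ} (hi : i < L) (hx : x < M) :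
    nextNode rel gain L M i x < M ∧ rel i x (nextNode rel gain L M i x) ∧
      bestGain rel gain L M (L - i) x = gain i (nextNode rel gain L M i x) +
        bestGain rel gain L M (L - 1 - i) (nextNode rel gain L M i x) := by
  have key : ∃ y < M, rel i x y ∧ bestGainNode rel gain L M (L - i) x =
      gain i y + bestGainNode rel gain L M (L - 1 - i) y := by
    obtain ⟨r, hr⟩ : ∃ r, L - i = r + 1 := ⟨L - i - 1, by omega⟩
    have hri : L - 1 - r = i := by omega
    have hir : L - 1 - i = r := by omega
    have hb : bestGainNode rel gain L M (L - i) x = bestGain rel gain L M (r + 1) x := by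
      rw [bestGainNode, if_pos hx, min_eq_left (by omega), hr]
    have hb' : ∀ y < M, bestGainNode rel gain L M (L - 1 - i) y = bestGain rel gain L M r y := by
      intro y hy
      rw [bestGainNode, if_pos hy, min_eq_left (by omega), hir]
    rw [hb, bestGain, hri]
    obtain ⟨y, hy, hsup⟩ := Finset.exists_mem_eq_sup (Finset.range M) ⟨0, by simpa using hM⟩
      fun y => open Classical in if rel i x y then gain i y + bestGain rel gain L M r y else 0
    by_cases hrel : rel i x y
    · refine ⟨y, Finset.mem_range.1 hy, hrel, ?_⟩
      rw [hsup, if_pos hrel, hb' y (Finset.mem_range.1 hy)]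
    -- The maximum is attained at a non-successor, hence equals `0`; then the admissible node `0`
    -- attains it as well.
    · refine ⟨0, hM, h0 i x, ?_⟩
      rw [hb' 0 hM]
      refine le_antisymm (by rw [hsup, if_neg hrel]; exact Nat.zero_le _) ?_
      refine le_trans ?_ (Finset.le_sup (Finset.mem_range.2 hM))
      rw [if_pos (h0 i x)]
  obtain ⟨h1, h2, h3⟩ := lastSat_spec key
  refine ⟨h1, h2, ?_⟩
  change nextNode rel gain L M i x < M at h1
  change bestGainNode rel gain L M (L - i) x = gain i (nextNode rel gain L M i x) +
    bestGainNode rel gain L M (L - 1 - i) (nextNode rel gain L M i x) at h3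
  rwa [bestGainNode, if_pos hx, min_eq_left (by omega), bestGainNode, if_pos h1,
    min_eq_left (by omega)] at h3

theorem bestPath_lt (hM : 0 < M) (h0 : ∀ i x, rel i x 0) {i : ℕ} (hi : i ≤ L) :
    bestPath rel gain L M i < M := by
  induction i with
  | zero => exact hM
  | succ i ih => exact (nextNode_spec hM h0 hi (ih (by omega))).1

theorem bestPath_rel (hM : 0 < M) (h0 : ∀ i x, rel i x 0) {i : ℕ} (hi : i < L) :
    rel i (bestPath rel gain L M i) (bestPath rel gain L M (i + 1)) :=
  (nextNode_spec hM h0 hi (bestPath_lt hM h0 hi.le)).2.1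

theorem sum_le_bestGain {q : ℕ → ℕ} (hq : ∀ i, q i < M) (hr : ∀ i < L, rel i (q i) (q (i + 1)))
    {r : ℕ} (hrL : r ≤ L) :
    ∑ i ∈ Finset.range r, gain (L - r + i) (q (L - r + i + 1))
      ≤ bestGain rel gain L M r (q (L - r)) := by
  induction r with
  | zero => simp
  | succ r ih =>
    rw [Finset.sum_range_succ']
    have e : ∀ i, L - (r + 1) + (i + 1) = L - r + i := fun i => by omega
    simp only [e]
    have e' : L - 1 - r = L - (r + 1) := by omega
    have e'' : L - (r + 1) + 0 + 1 = L - r := by omega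
    rw [bestGain, e', e'', Nat.add_zero]
    refine le_trans ?_ (Finset.le_sup (Finset.mem_range.2 (hq (L - r))))
    have := hr (L - (r + 1)) (by omega)
    rw [show L - (r + 1) + 1 = L - r by omega] at this
    rw [if_pos this, add_comm]
    exact Nat.add_le_add_left (ih (by omega)) _

theorem sum_bestPath (hM : 0 < M) (h0 : ∀ i x, rel i x 0) {r : ℕ} (hrL : r ≤ L) :
    ∑ i ∈ Finset.range r, gain (L - r + i) (bestPath rel gain L M (L - r + i + 1))
      = bestGain rel gain L M r (bestPath rel gain L M (L - r)) := by
  induction r with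
  | zero => simp [bestGain]
  | succ r ih =>
    rw [Finset.sum_range_succ']
    have e : ∀ i, L - (r + 1) + (i + 1) = L - r + i := fun i => by omega
    simp only [e]
    rw [ih (by omega), Nat.add_zero]
    have h := (nextNode_spec (gain := gain) (L := L) hM h0 (i := L - (r + 1)) (by omega)
      (bestPath_lt (gain := gain) hM h0 (Nat.sub_le L (r + 1)))).2.2
    change _ = gain _ (bestPath rel gain L M (L - (r + 1) + 1)) +
      bestGain rel gain L M _ (bestPath rel gain L M (L - (r + 1) + 1)) at h
    rw [show L - (L - (r + 1)) = r + 1 by omega, show L - 1 - (L - (r + 1)) = r by omega] at h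
    rw [h, show L - (r + 1) + 1 = L - r by omega, add_comm]

/-- The path `bestPath` is optimal. -/
theorem sum_le_sum_bestPath (hM : 0 < M) (h0 : ∀ i x, rel i x 0) {q : ℕ → ℕ} (hq0 : q 0 = 0)
    (hq : ∀ i, q i < M) (hr : ∀ i < L, rel i (q i) (q (i + 1))) :
    ∑ i ∈ Finset.range L, gain i (q (i + 1))
      ≤ ∑ i ∈ Finset.range L, gain i (bestPath rel gain L M (i + 1)) := by
  have h1 := sum_le_bestGain (gain := gain) hq hr le_rfl
  have h2 := sum_bestPath (gain := gain) hM h0 (le_refl L)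
  simp only [Nat.sub_self, Nat.zero_add] at h1 h2
  rw [h2]
  rw [hq0] at h1
  exact h1

end Layered

variable {ι : Type} {enc : ι → List ℕ} {rel : ι → ℕ → ℕ → ℕ → Prop} {gain : ι → ℕ → ℕ → ℕ}
  {L M : ι → ℕ}

/-- Row `r + 1` of the table of best gains depends only on row `r`, so `PT.iter` applies; its
cut-offs are those of `bestGainNode`. A successor is then found by search and the path by recursion.
Only the numbers of rows and nodes have to be polynomially bounded, not the gains. -/
theorem PT.bestPath (hL : Bd enc L) (hM : Bd enc M)
    (hrel : PP enc (m := 3) fun I _ v => rel I (v 0) (v 1) (v 2))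
    (hgain : PT enc (m := 2) fun I _ v => gain I (v 0) (v 1)) {m : ℕ}
    {e : ι → (ℕ → ℕ) → (Fin m → ℕ) → ℕ} (he : PT enc e) :
    PT enc fun I A v => RAM.bestPath (rel I) (gain I) (L I) (M I) (min (e I A v) (L I)) := by
  classical
  have h1 : PT enc (m := 2) fun I _ v =>
      bestGainNode (rel I) (gain I) (L I) (M I) (v 0) (v 1) := by
    refine PT.iter (m := 2) hM hL (Row := fun I _ r x => bestGain (rel I) (gain I) (L I) (M I) r x)
      (H := fun I A _ i x => (Finset.range (M I)).sup fun y =>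
        if rel I (L I - 1 - i) x y then gain I (L I - 1 - i) y + A y else 0)
      (.const 0) ?_ ?_ (.var 0) (.var 1)
    · have hs : PT enc fun I _ (w : Fin 5 → ℕ) => L I - 1 - w 2 :=
        (hL.pt.sub (.const 1)).sub (.var 2)
      exact PT.sup hM (f := fun I A (w : Fin 4 → ℕ) y => if rel I (L I - 1 - w 1) (w 0) y then
          gain I (L I - 1 - w 1) y + A y else 0)
        (.ite (hrel.comp₃ hs (.var 1) (.var 0))
          ((hgain.comp₂ hs (.var 0)).add (PT.var 0).oracle) (.const 0))
    · intro I v i x A hx hA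
      rw [bestGain]
      refine Finset.sup_congr rfl fun y hy => ?_
      rw [hA y (Finset.mem_range.1 hy)]
  have h2 : PT enc (m := 2) fun I _ v =>
      nextNode (rel I) (gain I) (L I) (M I) (v 0) (v 1) := by
    refine PT.lastSat hM (P := fun I _ (v : Fin 2 → ℕ) y => rel I (v 0) (v 1) y ∧
      bestGainNode (rel I) (gain I) (L I) (M I) (L I - v 0) (v 1) =
        gain I (v 0) y + bestGainNode (rel I) (gain I) (L I) (M I) (L I - 1 - v 0) y) ?_
    exact (hrel.comp₃ (.var 1) (.var 2) (.var 0)).and <| .eq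
      (h1.comp₂ (hL.pt.sub (.var 1)) (.var 2))
      ((hgain.comp₂ (.var 1) (.var 0)).add
        (h1.comp₂ ((hL.pt.sub (.const 1)).sub (.var 1)) (.var 0)))
  exact PT.fold hL (f := fun _ _ _ => 0) (h := fun I _ _ i x =>
    nextNode (rel I) (gain I) (L I) (M I) i x) he (.const 0) (h2.comp₂ (.var _) (.var _))

end RAM

namespace Firefighter

open SimpleGraph

variable {V : Type} {G : SimpleGraph V} {s : V}

/-! ### Dominators -/

/-- Every walk from `s` to `v` passes through `u`. -/
def Dominates (G : SimpleGraph V) (s u v : V) : Prop := ∀ w : G.Walk s v, u ∈ w.support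

theorem Dominates.refl (v : V) : Dominates G s v v := fun w => w.end_mem_support

theorem Dominates.trans {a u v : V} (h : Dominates G s a u) (h' : Dominates G s u v) :
    Dominates G s a v := by
  classical
  intro w
  exact w.support_takeUntil_subset_support (h' w) (h _)

/-- A shortest walk from `s` to `v` passes through `u` and can be split there. -/
theorem Dominates.dist_add (hG : G.Connected) {u v : V} (h : Dominates G s u v) :
    G.dist s u + G.dist u v = G.dist s v := by
  classical
  refine le_antisymm ?_ hG.dist_triangle
  obtain ⟨w, hw⟩ := hG.exists_walk_length_eq_dist s v
  rw [← hw, ← w.take_spec (h w), Walk.length_append]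
  exact Nat.add_le_add (dist_le _) (dist_le _)

theorem Dominates.dist_le (hG : G.Connected) {u v : V} (h : Dominates G s u v) :
    G.dist s u ≤ G.dist s v := by
  have := h.dist_add hG
  omega

theorem Dominates.eq_of_dist_le (hG : G.Connected) {u v : V} (h : Dominates G s u v)
    (h' : G.dist s v ≤ G.dist s u) : u = v := by
  have := h.dist_add hG
  exact hG.dist_eq_zero_iff.1 (by omega)

theorem Dominates.of_adj {u v p : V} (h : Dominates G s u v) (huv : u ≠ v) (hp : G.Adj p v) :
    Dominates G s u p := by
  intro w
  have := h (w.concat hp)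
  rw [Walk.support_concat, List.mem_append, List.mem_singleton] at this
  exact this.resolve_right huv

theorem exists_adj_dist (hG : G.Connected) {v : V} {i : ℕ} (hv : G.dist s v = i + 1) :
    ∃ p, G.Adj p v ∧ G.dist s p = i := by
  obtain ⟨w, hw⟩ := hG.exists_walk_length_eq_dist v s
  rw [dist_comm, hv] at hw
  cases w with
  | nil => simp at hw
  | @cons _ p _ h w =>
    refine ⟨p, h.symm, ?_⟩
    rw [Walk.length_cons] at hw
    have h1 := dist_le w
    rw [dist_comm] at h1
    have h2 := hG.dist_triangle (u := s) (v := p) (w := v)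
    rw [hv, dist_eq_one_iff_adj.2 h.symm] at h2
    omega

/-- In a tree, each vertex is dominated by a vertex at every smaller distance from `s`. -/
theorem exists_dominates (hG : G.IsTree) (v : V) {t : ℕ} (ht : t ≤ G.dist s v) :
    ∃ a, G.dist s a = t ∧ Dominates G s a v := by
  classical
  obtain ⟨p, hp, hl⟩ := hG.connected.exists_path_of_dist s v
  refine ⟨p.getVert t, ?_, fun w => ?_⟩
  · have h1 := dist_le (p.take t)
    have h2 := dist_le (p.drop t)
    have h3 := hG.connected.dist_triangle (u := s) (v := p.getVert t) (w := v)
    rw [Walk.take_length] at h1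
    rw [Walk.drop_length] at h2
    omega
  · have := (hG.isAcyclic.subsingleton_path s v).elim ⟨p, hp⟩ w.toPath
    have h1 : p = w.bypass := congrArg Subtype.val this
    rw [h1]
    exact w.support_bypass_subset_support (Walk.getVert_mem_support _ _)

/-! ### Strategies which protect each vertex at its distance from the origin -/

open Classical in
/-- The strategy which protects each vertex of `U` at the time equal to its distance from `s`. -/
noncomputable def levelStrategy (G : SimpleGraph V) (s : V) (U : Finset V) : Finset (V × ℕ) :=
  U.image fun u => (u, G.dist s u)

theorem mem_levelStrategy {U : Finset V} {q : V × ℕ} :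
    q ∈ levelStrategy G s U ↔ q.1 ∈ U ∧ q.2 = G.dist s q.1 := by
  simp only [levelStrategy, Finset.mem_image]
  constructor
  · rintro ⟨u, hu, rfl⟩
    exact ⟨hu, rfl⟩
  · rintro ⟨h1, h2⟩
    exact ⟨q.1, h1, by rw [← h2]⟩

/-- The fire advances one edge per time unit and stands still during the first; this delay makes
protection at time `G.dist s v` early enough. -/
theorem burned_dist_le (Φ : Finset (V × ℕ)) (hG : G.Connected) (t : ℕ) :
    ∀ v ∈ burned G s Φ t, G.dist s v ≤ t - 1 := by
  induction t with
  | zero => rintro v rfl; simp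
  | succ t ih =>
    rintro v (hv | ⟨ht, ⟨u, hu, huv⟩, -⟩)
    · exact (ih v hv).trans (by omega)
    · have h1 := hG.dist_triangle (u := s) (v := u) (w := v)
      rw [dist_eq_one_iff_adj.2 huv] at h1
      have := ih u hu
      omega

/-- The route of the fire avoids `U`: by the speed limit `burned_dist_le`, a vertex of `U` on it
would have been protected before the fire arrived. -/
theorem exists_walk_of_burned (hG : G.Connected) {U : Finset V} (hs : s ∉ U) (t : ℕ) :
    ∀ v ∈ burned G s (levelStrategy G s U) t, ∃ w : G.Walk s v, ∀ x ∈ w.support, x ∉ U := by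
  induction t with
  | zero =>
    rintro v rfl
    exact ⟨.nil, by simpa using hs⟩
  | succ t ih =>
    intro v hv'
    have hd := burned_dist_le _ hG _ v hv'
    obtain hv | ⟨ht, ⟨u, hu, huv⟩, hΦ⟩ := hv'
    · exact ih v hv
    · obtain ⟨w, hw⟩ := ih u hu
      refine ⟨w.concat huv, fun x hx => ?_⟩
      rw [Walk.support_concat, List.mem_append, List.mem_singleton] at hx
      obtain hx | rfl := hx
      · exact hw x hx
      · intro hxU
        exact hΦ (G.dist s x) hd (mem_levelStrategy.2 ⟨hxU, rfl⟩)

theorem saved_levelStrategy (hG : G.Connected) {U : Finset V} (hs : s ∉ U) {u v : V} (hu : u ∈ U)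
    (huv : Dominates G s u v) : Saved G s (levelStrategy G s U) v := by
  intro t ht
  obtain ⟨w, hw⟩ := exists_walk_of_burned hG hs t v ht
  exact hw u (huv w) hu

theorem dist_lt_card [Fintype V] (hG : G.Connected) (v : V) : G.dist s v < Fintype.card V := by
  obtain ⟨p, hp, hl⟩ := hG.exists_path_of_dist s v
  rw [← hl]
  exact hp.length_lt

theorem isValidStrategy_levelStrategy [Fintype V] (hG : G.Connected) {b : ℕ} {U : Finset V}
    (hs : s ∉ U) (hb : ∀ t, (U.filter fun u => G.dist s u = t).card ≤ b) :
    IsValidStrategy G s b (levelStrategy G s U) := by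
  classical
  have hpos : ∀ u ∈ U, 1 ≤ G.dist s u := fun u hu =>
    hG.pos_dist_of_ne fun h => hs (h ▸ hu)
  refine ⟨fun q hq => ?_, fun q hq h => ?_, fun t => le_trans ?_ (hb t)⟩
  · obtain ⟨h1, h2⟩ := mem_levelStrategy.1 hq
    rw [h2]
    exact ⟨hpos _ h1, (dist_lt_card hG _).le⟩
  · obtain ⟨h1, h2⟩ := mem_levelStrategy.1 hq
    have := burned_dist_le _ hG _ _ h
    have := hpos _ h1
    omega
  · refine Finset.card_le_card_of_injOn Prod.fst (fun q hq => ?_) ?_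
    · obtain ⟨h1, h2⟩ := Finset.mem_filter.1 hq
      obtain ⟨h3, h4⟩ := mem_levelStrategy.1 h1
      exact Finset.mem_filter.2 ⟨h3, h4 ▸ h2⟩
    · intro q hq r hr h
      have h1 := (Finset.mem_filter.1 hq).2
      have h2 := (Finset.mem_filter.1 hr).2
      exact Prod.ext h (h1.trans h2.symm)

/-- In a tree, a vertex saved by a strategy is dominated by a vertex which the strategy protects
in time. -/
theorem exists_dominates_of_saved (hG : G.IsTree) {Φ : Finset (V × ℕ)} {v : V}
    (hv : Saved G s Φ v) : ∃ q ∈ Φ, q.2 ≤ G.dist s q.1 ∧ Dominates G s q.1 v := by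
  by_contra! hcon
  -- If no ancestor of `v` is protected in time, the fire runs unhindered down the chain of
  -- ancestors, reaching distance `i` at time `i + 1`.
  have key : ∀ i a, G.dist s a = i → Dominates G s a v → a ∈ burned G s Φ (i + 1) := by
    intro i
    induction i with
    | zero =>
      intro a ha _
      rw [hG.connected.dist_eq_zero_iff] at ha
      subst ha
      exact Or.inl rfl
    | succ i ih =>
      intro a ha hav
      obtain ⟨p, hp, hpa⟩ := exists_dominates hG (s := s) a (t := i) (by omega)
      have hadj : G.Adj p a := by
        rw [← dist_eq_one_iff_adj]
        have := hpa.dist_add hG.connected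
        omega
      refine Or.inr ⟨by omega, ⟨p, ih p hp (hpa.trans hav), hadj⟩, fun j hj hΦ => ?_⟩
      exact hcon (a, j) hΦ (by simpa [ha] using hj) hav
  exact hv _ (key _ v rfl (.refl v))

/-- In a tree, the vertices saved by a valid strategy are dominated by a set of at most `b` vertices
at each positive distance from `s`, none of which dominates another one. -/
theorem exists_antichain (hG : G.IsTree) [Fintype V] {b : ℕ} {Φ : Finset (V × ℕ)}
    (hΦ : IsValidStrategy G s b Φ) :
    ∃ U : Finset V, s ∉ U ∧ (∀ t, (U.filter fun u => G.dist s u = t).card ≤ b) ∧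
      (∀ u ∈ U, ∀ u' ∈ U, Dominates G s u u' → u = u') ∧
      ∀ v, Saved G s Φ v → ∃ u ∈ U, Dominates G s u v := by
  classical
  -- For a protection `q` made in time, `a` is the ancestor of `q.1` at distance `q.2`. It saves at
  -- least as much, and the budget per time becomes a budget per distance.
  have h0 : ∀ q : V × ℕ, ∃ a, q.2 ≤ G.dist s q.1 → G.dist s a = q.2 ∧ Dominates G s a q.1 := by
    intro q
    by_cases hq : q.2 ≤ G.dist s q.1
    · obtain ⟨a, ha⟩ := exists_dominates hG (s := s) q.1 hq
      exact ⟨a, fun _ => ha⟩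
    · exact ⟨s, fun h => absurd h hq⟩
  choose anc hanc using h0
  set U' := (Φ.filter fun q => q.2 ≤ G.dist s q.1).image anc with hU'
  have hU'mem : ∀ u ∈ U', ∃ q ∈ Φ, G.dist s u = q.2 ∧ anc q = u := by
    intro u hu
    obtain ⟨q, hq, rfl⟩ := Finset.mem_image.1 hu
    obtain ⟨h1, h2⟩ := Finset.mem_filter.1 hq
    exact ⟨q, h1, (hanc q h2).1, rfl⟩
  refine ⟨U'.filter fun u => ∀ u' ∈ U', Dominates G s u' u → u' = u, ?_, ?_, ?_, ?_⟩
  · intro hs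
    obtain ⟨q, hq, h1, -⟩ := hU'mem s (Finset.mem_filter.1 hs).1
    have := (hΦ.1 q hq).1
    rw [dist_self] at h1
    omega
  · intro t
    refine le_trans ?_ (hΦ.2.2 t)
    refine le_trans (Finset.card_le_card (t := (Φ.filter fun q => q.2 = t).image anc) ?_)
      Finset.card_image_le
    intro u hu
    obtain ⟨h1, h2⟩ := Finset.mem_filter.1 hu
    obtain ⟨q, hq, h3, h4⟩ := hU'mem u (Finset.mem_filter.1 h1).1
    exact Finset.mem_image.2 ⟨q, Finset.mem_filter.2 ⟨hq, h3.symm.trans h2⟩, h4⟩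
  · intro u hu u' hu' h
    exact (Finset.mem_filter.1 hu').2 u (Finset.mem_filter.1 hu).1 h
  · intro v hv
    obtain ⟨q, hq, h1, h2⟩ := exists_dominates_of_saved hG hv
    have hne : (U'.filter fun u => Dominates G s u v).Nonempty :=
      ⟨anc q, Finset.mem_filter.2 ⟨Finset.mem_image.2 ⟨q, Finset.mem_filter.2 ⟨hq, h1⟩, rfl⟩,
        (hanc q h1).2.trans h2⟩⟩
    -- The ancestor of `v` in `U'` nearest to `s` survives the passage to topmost vertices.
    obtain ⟨u, hu, hmin⟩ := Finset.exists_min_image _ (G.dist s) hne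
    obtain ⟨hu1, hu2⟩ := Finset.mem_filter.1 hu
    refine ⟨u, Finset.mem_filter.2 ⟨hu1, fun u' hu' h => ?_⟩, hu2⟩
    exact h.eq_of_dist_le hG.connected (hmin u' (Finset.mem_filter.2 ⟨hu', h.trans hu2⟩))

/-! ### Narrow trees -/

/-- Apart from vertices which dominate no vertex at distance `k` or more, the vertices of `G` can be
divided into `k + 3` classes of vertices which dominate each other. -/
def IsNarrow (k : ℕ) (G : SimpleGraph V) (s : V) : Prop :=
  ∃ c : V → Option (Fin (k + 3)),
    (∀ u v, c u ≠ none → c u = c v → Dominates G s u v ∨ Dominates G s v u) ∧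
    ∀ u v, c u = none → Dominates G s u v → G.dist s v < G.dist s u + k

open Classical in
/-- The vertices of `U` which dominate a vertex at distance `i` from `s`. -/
noncomputable def active (G : SimpleGraph V) (s : V) (U : Finset V) (i : ℕ) : Finset V :=
  U.filter fun u => ∃ v, G.dist s v = i ∧ Dominates G s u v

theorem mem_active {U : Finset V} {i : ℕ} {u : V} :
    u ∈ active G s U i ↔ u ∈ U ∧ ∃ v, G.dist s v = i ∧ Dominates G s u v := by
  simp [active]

theorem active_succ (hG : G.Connected) {U : Finset V} {i : ℕ} {u : V}
    (hu : u ∈ active G s U (i + 1)) : u ∈ active G s U i ∨ G.dist s u = i + 1 := by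
  obtain ⟨h1, v, hv, huv⟩ := mem_active.1 hu
  by_cases h : u = v
  · exact Or.inr (h ▸ hv)
  · obtain ⟨p, hp, hpi⟩ := exists_adj_dist hG hv
    exact Or.inl (mem_active.2 ⟨h1, p, hpi, huv.of_adj h hp⟩)

/-- An antichain has at most one vertex in each of the `k + 3` classes. An active vertex without a
class lies at a distance in the interval from `i - k + 1` to `i`, and each distance carries at most
`b` vertices of `U`. -/
theorem card_active_le {k b : ℕ} (hG : G.Connected) (hn : IsNarrow k G s) {U : Finset V}
    (hb : ∀ t, (U.filter fun u => G.dist s u = t).card ≤ b)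
    (hU : ∀ u ∈ U, ∀ u' ∈ U, Dominates G s u u' → u = u') (i : ℕ) :
    (active G s U i).card ≤ b * k + (k + 3) := by
  classical
  obtain ⟨c, hc1, hc2⟩ := hn
  have h1 : ((active G s U i).filter fun u => c u = none).card ≤ b * k := by
    refine (Finset.card_le_mul_card_image (f := fun u => i - G.dist s u) _ b ?_).trans
      (Nat.mul_le_mul_left b (le_trans (Finset.card_le_card (t := Finset.range k) ?_) (by simp)))
    · intro r hr
      refine le_trans (Finset.card_le_card ?_) (hb (i - r))
      intro u hu
      obtain ⟨h2, h3⟩ := Finset.mem_filter.1 hu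
      obtain ⟨h4, v, hv, huv⟩ := mem_active.1 (Finset.mem_filter.1 h2).1
      have := huv.dist_le hG
      exact Finset.mem_filter.2 ⟨h4, by omega⟩
    · intro r hr
      obtain ⟨u, hu, rfl⟩ := Finset.mem_image.1 hr
      obtain ⟨h2, h3⟩ := Finset.mem_filter.1 hu
      obtain ⟨h4, v, hv, huv⟩ := mem_active.1 h2
      have := hc2 u v h3 huv
      have := huv.dist_le hG
      exact Finset.mem_range.2 (by omega)
  have h2 : ((active G s U i).filter fun u => ¬ c u = none).card ≤ k + 3 := by
    have : ((active G s U i).filter fun u => ¬ c u = none).card ≤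
        (Finset.univ.image (some : Fin (k + 3) → Option (Fin (k + 3)))).card := by
      refine Finset.card_le_card_of_injOn c (fun u hu => ?_) ?_
      · obtain ⟨-, h3⟩ := Finset.mem_filter.1 hu
        obtain ⟨x, hx⟩ := Option.ne_none_iff_exists.1 h3
        simp [← hx]
      · intro u hu v hv huv
        obtain ⟨h3, h4⟩ := Finset.mem_filter.1 hu
        obtain ⟨h5, h6⟩ := Finset.mem_filter.1 hv
        have h7 := (mem_active.1 h3).1
        have h8 := (mem_active.1 h5).1
        obtain h | h := hc1 u v h4 huv
        · exact hU u h7 v h8 h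
        · exact (hU v h8 u h7 h).symm
    refine this.trans (Finset.card_image_le.trans (by simp))
  have h3 := Finset.card_filter_add_card_filter_not (s := active G s U i) (fun u => c u = none)
  omega

/-! ### Graph isomorphisms -/

theorem Dominates.iso {W : Type} {H : SimpleGraph W} (φ : G ≃g H) {u v : V}
    (h : Dominates H (φ s) (φ u) (φ v)) : Dominates G s u v := by
  intro w
  have := h (w.map φ.toHom)
  rw [Walk.support_map, List.mem_map] at this
  obtain ⟨x, hx, hxu⟩ := this
  rwa [← φ.injective hxu]

theorem dist_iso {W : Type} {H : SimpleGraph W} (hG : G.Connected) (φ : G ≃g H) (u v : V) :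
    H.dist (φ u) (φ v) = G.dist u v := by
  have hH : H.Connected := (Iso.connected_iff φ).1 hG
  refine le_antisymm ?_ ?_
  · obtain ⟨w, hw⟩ := hG.exists_walk_length_eq_dist u v
    rw [← hw, ← Walk.length_map φ.toHom w]
    exact dist_le _
  · obtain ⟨w, hw⟩ := hH.exists_walk_length_eq_dist (φ u) (φ v)
    rw [← hw]
    have := dist_le ((w.map φ.symm.toHom).copy (φ.symm_apply_apply u) (φ.symm_apply_apply v))
    rwa [Walk.length_copy, Walk.length_map] at this

theorem IsNarrow.iso {W : Type} {H : SimpleGraph W} {k : ℕ} (hG : G.Connected) (φ : G ≃g H)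
    (h : IsNarrow k H (φ s)) : IsNarrow k G s := by
  obtain ⟨c, h1, h2⟩ := h
  refine ⟨fun v => c (φ v), fun u v hu huv => ?_, fun u v hu huv => ?_⟩
  · exact (h1 _ _ hu huv).imp (Dominates.iso φ) (Dominates.iso φ)
  · have := h2 (φ u) (φ v) hu <| Dominates.iso φ.symm <| by simpa using huv
    rwa [dist_iso hG, dist_iso hG] at this

end Firefighter

namespace Firefighter

open SimpleGraph

/-! ### Trees of the form of a spine with legs -/

/-- `xy` is the only edge of `G` between the complement of `Z` and `Z`. -/
def IsCut {V : Type} (G : SimpleGraph V) (Z : Set V) (x y : V) : Prop :=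
  x ∉ Z ∧ y ∈ Z ∧ ∀ a b, G.Adj a b → a ∉ Z → b ∈ Z → a = x ∧ b = y

theorem IsCut.compl {V : Type} {G : SimpleGraph V} {Z : Set V} {x y : V} (h : IsCut G Z x y) :
    IsCut G Zᶜ y x :=
  ⟨fun h' => h' h.2.1, h.1, fun a b hab ha hb => (h.2.2 b a hab.symm hb (not_not.1 ha)).symm⟩

theorem IsCut.isBridge {V : Type} {G : SimpleGraph V} {Z : Set V} {x y : V}
    (h : IsCut G Z x y) : G.IsBridge s(x, y) := by
  rw [isBridge_iff]
  rintro ⟨w⟩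
  have key : ∀ a b (w : (G \ fromEdgeSet {s(x, y)}).Walk a b), a ∉ Z → b ∉ Z := by
    intro a b w
    induction w with
    | nil => exact id
    | @cons a c b hac w ih =>
      intro ha
      refine ih fun hc => ?_
      rw [sdiff_adj, fromEdgeSet_adj] at hac
      obtain ⟨rfl, rfl⟩ := h.2.2 a c hac.1 ha hc
      exact hac.2 ⟨rfl, hac.1.ne⟩
  exact key x y w h.1 h.2.1

/-- A walk from outside `Z` into `Z` has to cross over at some step, and the only edge available
ends in `y`. -/
theorem IsCut.dominates {V : Type} {G : SimpleGraph V} {Z : Set V} {x y s v : V}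
    (h : IsCut G Z x y) (hs : s ∉ Z) (hv : v ∈ Z) : Dominates G s y v := by
  intro w
  induction w with
  | nil => exact absurd hv hs
  | @cons a c b hac w ih =>
    by_cases hc : c ∈ Z
    · obtain ⟨rfl, rfl⟩ := h.2.2 a c hac hs hc
      simp
    · rw [Walk.support_cons]
      exact List.mem_cons_of_mem _ (ih hc hv)

variable {p m : ℕ} {foot : Fin m → Fin p} {len : Fin m → ℕ}

/-- The spine vertex where the leg of a vertex begins, or the vertex itself if it is on the
spine. -/
def spineIndex (foot : Fin m → Fin p) (len : Fin m → ℕ) : SpineLegs p m len → ℕ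
  | .inl i => i.val
  | .inr x => (foot x.1).val

/-- Leg edges leave `spineIndex` unchanged and spine edges change it by one, so only one edge
separates the large indices from the small ones. -/
theorem isCut_spine {i i' : Fin p} (h : i.val + 1 = i'.val) :
    IsCut (spineLegsGraph foot len) {v | i'.val ≤ spineIndex foot len v} (.inl i) (.inl i') := by
  refine ⟨?_, ?_, ?_⟩
  · simp [spineIndex]; omega
  · simp [spineIndex]
  · rintro (a | ⟨j, r⟩) (b | ⟨j', r'⟩) hab ha hb
    all_goals
      simp only [spineLegsGraph, fromRel_adj, spineLegsRel, Set.mem_ofPred_eq, spineIndex] at hab ha hb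
    · have h1 : a = i := Fin.ext (by omega)
      have h2 : b = i' := Fin.ext (by omega)
      exact ⟨by rw [h1], by rw [h2]⟩
    · obtain ⟨-, ⟨h1, -⟩ | h1⟩ := hab
      · rw [h1] at hb; omega
      · exact h1.elim
    · obtain ⟨-, h1 | ⟨h1, -⟩⟩ := hab
      · exact h1.elim
      · rw [h1] at ha; omega
    · obtain ⟨-, ⟨h1, -⟩ | ⟨h1, -⟩⟩ := hab <;> (simp only [h1] at ha hb; omega)

/-- The edge towards the spine cuts off the outer part of the leg. Taking `x` as the predecessor
under `spineLegsRel` covers both a foot on the spine and an earlier leg vertex. -/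
theorem isCut_leg {x : SpineLegs p m len} {j : Fin m} {r : Fin (len j)}
    (h : spineLegsRel foot len x (.inr ⟨j, r⟩)) :
    IsCut (spineLegsGraph foot len) {v | ∃ r', r ≤ r' ∧ v = .inr ⟨j, r'⟩} x (.inr ⟨j, r⟩) := by
  have hx : x ∉ {v : SpineLegs p m len | ∃ r', r ≤ r' ∧ v = .inr ⟨j, r'⟩} := by
    rintro ⟨r', hr, rfl⟩
    have h2 : r'.val + 1 = r.val := h.2
    have : r.val ≤ r'.val := hr
    omega
  refine ⟨hx, ⟨r, le_rfl, rfl⟩, ?_⟩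
  rintro a _ hab ha ⟨r', hr, rfl⟩
  simp only [spineLegsGraph, fromRel_adj] at hab
  have hr' : r.val ≤ r'.val := hr
  obtain ⟨-, h1 | h1⟩ := hab
  · have h3 : r' = r := by
      obtain i | ⟨j', t⟩ := a
      · have : r'.val = 0 := h1.2
        exact Fin.ext (by omega)
      · obtain ⟨h4, h5⟩ := h1
        dsimp only at h4 h5
        subst h4
        by_contra hne
        have : r'.val ≠ r.val := fun h => hne (Fin.ext h)
        exact ha ⟨t, by rw [Fin.le_def]; omega, rfl⟩
    subst h3
    refine ⟨?_, rfl⟩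
    obtain i | ⟨j', t⟩ := a <;> obtain i' | ⟨j'', t'⟩ := x
    · rw [← h.1, ← h1.1]
    · have h4 : r'.val = 0 := h1.2
      have h5 : t'.val + 1 = r'.val := h.2
      omega
    · have h4 : r'.val = 0 := h.2
      have h5 : t.val + 1 = r'.val := h1.2
      omega
    · obtain ⟨h4, h5⟩ := h1
      obtain ⟨h6, h7⟩ := h
      dsimp only at h4 h5 h6 h7
      subst h4 h6
      have : t = t' := Fin.ext (by omega)
      rw [this]
  · obtain i | ⟨j', t⟩ := a
    · exact h1.elim
    · obtain ⟨h4, h5⟩ := h1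
      dsimp only at h4 h5
      subst h4
      exact absurd ⟨t, by rw [Fin.le_def]; omega, rfl⟩ ha

theorem exists_leg_walk (j : Fin m) (r : ℕ) (hr : r < len j) :
    ∃ w : (spineLegsGraph foot len).Walk (.inr ⟨j, ⟨r, hr⟩⟩) (.inl (foot j)),
      ∀ x ∈ w.support, x = .inl (foot j) ∨ ∃ r' : Fin (len j), r'.val ≤ r ∧ x = .inr ⟨j, r'⟩ := by
  induction r with
  | zero =>
    have h : (spineLegsGraph foot len).Adj (.inr ⟨j, ⟨0, hr⟩⟩) (.inl (foot j)) := by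
      simp [spineLegsGraph, spineLegsRel]
    refine ⟨.cons h .nil, fun x hx => ?_⟩
    simp only [Walk.support_cons, Walk.support_nil, List.mem_cons, List.not_mem_nil,
      or_false] at hx
    exact hx.symm.imp id fun h => ⟨_, le_rfl, h⟩
  | succ r ih =>
    obtain ⟨w, hw⟩ := ih (by omega)
    have h : (spineLegsGraph foot len).Adj (.inr ⟨j, ⟨r + 1, hr⟩⟩)
        (.inr ⟨j, ⟨r, by omega⟩⟩) := by
      simp [spineLegsGraph, spineLegsRel]
    refine ⟨.cons h w, fun x hx => ?_⟩
    rw [Walk.support_cons, List.mem_cons] at hx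
    obtain rfl | hx := hx
    · exact Or.inr ⟨_, le_rfl, rfl⟩
    · exact (hw x hx).imp id fun ⟨r', h1, h2⟩ => ⟨r', by omega, h2⟩

theorem exists_spine_walk (i i' : Fin p) :
    ∃ w : (spineLegsGraph foot len).Walk (.inl i) (.inl i'),
      ∀ x ∈ w.support, ∃ t : Fin p, x = .inl t := by
  have key : ∀ (n : ℕ) (hn : n < p),
      ∃ w : (spineLegsGraph foot len).Walk (.inl ⟨n, hn⟩) (.inl ⟨0, by omega⟩),
        ∀ x ∈ w.support, ∃ t : Fin p, x = .inl t := by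
    intro n
    induction n with
    | zero => exact fun hn => ⟨.nil, fun x hx => ⟨_, by simpa using hx⟩⟩
    | succ n ih =>
      intro hn
      obtain ⟨w, hw⟩ := ih (by omega)
      have h : (spineLegsGraph foot len).Adj (.inl ⟨n + 1, hn⟩) (.inl ⟨n, by omega⟩) := by
        simp [spineLegsGraph, spineLegsRel]
      refine ⟨.cons h w, fun x hx => ?_⟩
      rw [Walk.support_cons, List.mem_cons] at hx
      obtain rfl | hx := hx
      · exact ⟨_, rfl⟩
      · exact hw x hx
  obtain ⟨w, hw⟩ := key i i.2
  obtain ⟨w', hw'⟩ := key i' i'.2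
  refine ⟨w.append w'.reverse, fun x hx => ?_⟩
  rw [Walk.mem_support_append_iff, Walk.support_reverse, List.mem_reverse] at hx
  exact hx.elim (hw x) (hw' x)

/-- Two vertices off the outer part of a leg are thus joined through the spine around its first
vertex; this shows that a leg without `s` dominates only its own outer vertices. -/
theorem exists_walk_to_spine {j : Fin m} {r : Fin (len j)} {v : SpineLegs p m len}
    (hv : ∀ r', r ≤ r' → v ≠ .inr ⟨j, r'⟩) :
    ∃ (i : Fin p) (w : (spineLegsGraph foot len).Walk v (.inl i)), .inr ⟨j, r⟩ ∉ w.support := by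
  obtain i | ⟨j', t⟩ := v
  · exact ⟨i, .nil, by simp⟩
  · obtain ⟨w, hw⟩ := exists_leg_walk (foot := foot) j' t.1 t.2
    refine ⟨_, w, fun h => ?_⟩
    obtain h1 | ⟨r', h1, h2⟩ := hw _ h
    · simp at h1
    · obtain rfl : j = j' := by simpa using congrArg (fun x => x.elim (fun _ => j) Sigma.fst) h2
      obtain rfl : r = r' := by simpa using h2
      exact hv t h1 rfl

theorem dist_leg_le (j : Fin m) (r n : ℕ) (hn : r + n < len j) :
    (spineLegsGraph foot len).dist (.inr ⟨j, ⟨r, by omega⟩⟩) (.inr ⟨j, ⟨r + n, hn⟩⟩) ≤ n := by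
  have key : ∃ w : (spineLegsGraph foot len).Walk (.inr ⟨j, ⟨r, by omega⟩⟩)
      (.inr ⟨j, ⟨r + n, hn⟩⟩), w.length ≤ n := by
    induction n with
    | zero => exact ⟨.nil, le_rfl⟩
    | succ n ih =>
      obtain ⟨w, hw⟩ := ih (by omega)
      have h : (spineLegsGraph foot len).Adj (.inr ⟨j, ⟨r + n, by omega⟩⟩)
          (.inr ⟨j, ⟨r + (n + 1), hn⟩⟩) := by
        simp [spineLegsGraph, spineLegsRel]; omega
      exact ⟨w.concat h, by rw [Walk.length_concat]; omega⟩
  obtain ⟨w, hw⟩ := key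
  exact (dist_le w).trans hw

/-- Every edge is a cut edge by `isCut_spine` or `isCut_leg`, hence a bridge, so there is no cycle.
-/
theorem isTree_spineLegsGraph (hp : 1 ≤ p) : (spineLegsGraph foot len).IsTree := by
  refine ⟨?_, ?_⟩
  · have h : ∀ v, (spineLegsGraph foot len).Reachable v (.inl ⟨0, hp⟩) := by
      intro v
      have : ∃ i, (spineLegsGraph foot len).Reachable v (.inl i) := by
        obtain i | ⟨j, t⟩ := v
        · exact ⟨i, .refl _⟩
        · exact ⟨_, (exists_leg_walk j t.1 t.2).choose.reachable⟩
      obtain ⟨i, hi⟩ := this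
      exact hi.trans (exists_spine_walk i _).choose.reachable
    have : Nonempty (SpineLegs p m len) := ⟨.inl ⟨0, hp⟩⟩
    exact ⟨fun u v => (h u).trans (h v).symm⟩
  · rw [isAcyclic_iff_forall_adj_isBridge]
    have key : ∀ v w, spineLegsRel foot len v w →
        (spineLegsGraph foot len).IsBridge s(v, w) := by
      rintro (i | ⟨j, t⟩) (i' | ⟨j', t'⟩) h
      · exact (isCut_spine h).isBridge
      · exact (isCut_leg h).isBridge
      · exact h.elim
      · exact (isCut_leg h).isBridge
    intro v w hvw
    obtain ⟨-, h | h⟩ := (fromRel_adj _ _ _).1 hvw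
    · exact key v w h
    · rw [Sym2.eq_swap]
      exact key w v h

theorem isNarrow_spineLegsGraph {k : ℕ} (hp : 1 ≤ p) (hk : ∀ j, len j ≤ k)
    (s : SpineLegs p m len) : IsNarrow k (spineLegsGraph foot len) s := by
  classical
  have hconn := (isTree_spineLegsGraph (foot := foot) (len := len) hp).connected
  set f := spineIndex foot len s with hf
  -- With `f` the spine position of `s` or of the foot of its leg, classes `0`, `1`, `2` are the
  -- spine before, at and after `f`. The vertex number `t` of the leg of `s` forms class `t + 3`
  -- alone; other legs have no class.
  have hclass : ∀ v : SpineLegs p m len, ∃ o : Option (Fin (k + 3)),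
      match v with
      | .inl i => (i.val < f ∧ o = some 0) ∨ (i.val = f ∧ o = some 1) ∨ (f < i.val ∧ o = some 2)
      | .inr x => ((∃ r, s = .inr ⟨x.1, r⟩) ∧ ∃ h : x.2.val + 3 < k + 3, o = some ⟨x.2.val + 3, h⟩) ∨
          ((∀ r, s ≠ .inr ⟨x.1, r⟩) ∧ o = none) := by
    rintro (i | ⟨j, t⟩)
    · obtain h | h | h := lt_trichotomy i.val f
      · exact ⟨_, Or.inl ⟨h, rfl⟩⟩
      · exact ⟨_, Or.inr (Or.inl ⟨h, rfl⟩)⟩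
      · exact ⟨_, Or.inr (Or.inr ⟨h, rfl⟩)⟩
    · by_cases h : ∃ r, s = .inr ⟨j, r⟩
      · have : t.val < k := t.2.trans_le (hk j)
        exact ⟨_, Or.inl ⟨h, by dsimp only; omega, rfl⟩⟩
      · exact ⟨_, Or.inr ⟨fun r hr => h ⟨r, hr⟩, rfl⟩⟩
  choose c hc using hclass
  have h0 : (0 : Fin (k + 3)).val = 0 := rfl
  have h1 : (1 : Fin (k + 3)).val = 1 := rfl
  have h2 : (2 : Fin (k + 3)).val = 2 := rfl
  have hright : ∀ i i' : Fin p, f < i.val → i.val ≤ i'.val →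
      Dominates (spineLegsGraph foot len) s (.inl i) (.inl i') := by
    intro i i' hi hii
    exact (isCut_spine (i := ⟨i.val - 1, by omega⟩) (i' := i)
      (by dsimp only; omega)).dominates (by simpa [hf] using hi) (by simpa [spineIndex] using hii)
  have hleft : ∀ i i' : Fin p, i.val < f → i'.val ≤ i.val →
      Dominates (spineLegsGraph foot len) s (.inl i) (.inl i') := by
    intro i i' hi hii
    have hfp : f < p := by
      rw [hf]
      obtain a | a := s
      · exact a.2
      · exact (foot a.1).2
    exact (isCut_spine (i := i) (i' := ⟨i.val + 1, by omega⟩) rfl).compl.dominates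
      (by simp only [Set.mem_compl_iff, Set.mem_ofPred_eq, not_not]; exact hi)
      (by simp [spineIndex]; omega)
  refine ⟨c, ?_, ?_⟩
  · intro u v hu huv
    have hcu := hc u
    have hcv := hc v
    obtain i | ⟨j, t⟩ := u <;> obtain i' | ⟨j', t'⟩ := v
    · dsimp only at hcu hcv
      rw [← huv] at hcv
      obtain ⟨h3, h4⟩ | ⟨h3, h4⟩ | ⟨h3, h4⟩ := hcu <;>
        obtain ⟨h5, h6⟩ | ⟨h5, h6⟩ | ⟨h5, h6⟩ := hcv <;> rw [h4] at h6 <;>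
        simp only [Option.some.injEq, Fin.ext_iff, h0, h1, h2] at h6 <;> try omega
      · exact (le_total i.val i'.val).symm.imp (hleft _ _ h3) (hleft _ _ h5)
      · obtain rfl : i = i' := Fin.ext (by omega)
        exact Or.inl (.refl _)
      · exact (le_total i.val i'.val).imp (hright _ _ h3) (hright _ _ h5)
    · dsimp only at hcu hcv
      rw [← huv] at hcv
      obtain ⟨-, _, h7⟩ | ⟨-, h7⟩ := hcv
      · obtain ⟨h3, h4⟩ | ⟨h3, h4⟩ | ⟨h3, h4⟩ := hcu <;> rw [h4] at h7 <;>
          simp only [Option.some.injEq, Fin.ext_iff, h0, h1, h2] at h7 <;> omega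
      · exact absurd h7 hu
    · dsimp only at hcu hcv
      rw [huv] at hcu hu
      obtain ⟨-, _, h7⟩ | ⟨-, h7⟩ := hcu
      · obtain ⟨h3, h4⟩ | ⟨h3, h4⟩ | ⟨h3, h4⟩ := hcv <;> rw [h4] at h7 <;>
          simp only [Option.some.injEq, Fin.ext_iff, h0, h1, h2] at h7 <;> omega
      · exact absurd h7 hu
    · dsimp only at hcu hcv
      rw [← huv] at hcv
      obtain ⟨⟨r, hr⟩, h5, h6⟩ | ⟨-, h6⟩ := hcu
      · obtain ⟨⟨r', hr'⟩, h7, h8⟩ | ⟨-, h8⟩ := hcv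
        · rw [h6] at h8
          simp only [Option.some.injEq, Fin.ext_iff] at h8
          obtain rfl : j = j' := by
            simpa using congrArg (fun x => x.elim (fun _ => j) Sigma.fst) (hr.symm.trans hr')
          obtain rfl : t = t' := Fin.ext (by omega)
          exact Or.inl (.refl _)
        · exact absurd h8 hu
      · exact absurd h6 hu
  · intro u v hu huv
    have hcu := hc u
    obtain i | ⟨j, t⟩ := u
    · dsimp only at hcu
      rw [hu] at hcu
      simp at hcu
    · dsimp only at hcu
      rw [hu] at hcu
      obtain ⟨-, _, h⟩ | ⟨hs, -⟩ := hcu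
      · simp at h
      -- Otherwise `s` and `v` are joined through the spine by a walk that avoids `u`. So `v` is
      -- farther out on the leg, at most `k - 1` steps from `u`.
      have hv : ∃ r', t ≤ r' ∧ v = .inr ⟨j, r'⟩ := by
        by_contra! hv
        obtain ⟨i, w, hw⟩ := exists_walk_to_spine (foot := foot) (r := t) fun r' _ => hs r'
        obtain ⟨i', w', hw'⟩ := exists_walk_to_spine (foot := foot) hv
        obtain ⟨w'', hw''⟩ := exists_spine_walk (foot := foot) (len := len) i i'
        have h := huv ((w.append w'').append w'.reverse)
        rw [Walk.mem_support_append_iff, Walk.mem_support_append_iff, Walk.support_reverse,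
          List.mem_reverse] at h
        obtain (h | h) | h := h
        · exact hw h
        · obtain ⟨t, ht⟩ := hw'' _ h
          simp at ht
        · exact hw' h
      obtain ⟨r', hr, rfl⟩ := hv
      have hr' : t.val ≤ r'.val := hr
      have h3 := dist_leg_le (foot := foot) (len := len) j t.val (r'.val - t.val) (by omega)
      have h4 : (⟨t.val + (r'.val - t.val), by omega⟩ : Fin (len j)) = r' :=
        Fin.ext (by dsimp only; omega)
      rw [h4] at h3
      have h5 := hconn.dist_triangle (u := s) (v := .inr ⟨j, t⟩) (w := .inr ⟨j, r'⟩)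
      have h6 := r'.2
      have h7 := hk j
      have h8 : (spineLegsGraph foot len).dist (.inr ⟨j, t⟩) (.inr ⟨j, r'⟩) ≤ r'.val - t.val := h3
      omega

theorem IsCaterpillar.isTree {V : Type} {k : ℕ} {G : SimpleGraph V} (h : IsCaterpillar k G) :
    G.IsTree := by
  obtain ⟨p, m, foot, len, hp, -, ⟨φ⟩⟩ := h
  exact φ.isTree_iff.2 (isTree_spineLegsGraph hp)

theorem IsCaterpillar.isNarrow {V : Type} {k : ℕ} {G : SimpleGraph V} (h : IsCaterpillar k G)
    (s : V) : IsNarrow k G s := by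
  have hG := h.isTree.connected
  obtain ⟨p, m, foot, len, hp, hlen, ⟨φ⟩⟩ := h
  exact (isNarrow_spineLegsGraph hp (fun j => (hlen j).2) (φ s)).iso hG φ

end Firefighter

namespace Firefighter

open SimpleGraph RAM

/-! ### Reading the instance -/

theorem getD_flatMap {α : Type} {n : ℕ} (g : α → List ℕ) (hg : ∀ a, (g a).length = n) (l : List α)
    {i j : ℕ} (hi : i < l.length) (hj : j < n) :
    (l.flatMap g).getD (i * n + j) 0 = (g l[i]).getD j 0 := by
  induction l generalizing i with
  | nil => simp at hi
  | cons a l ih =>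
    rw [List.flatMap_cons]
    cases i with
    | zero =>
      rw [Nat.zero_mul, Nat.zero_add, List.getD_append _ _ _ _ (by rw [hg]; exact hj)]
      rfl
    | succ i =>
      have e : (i + 1) * n + j = n + (i * n + j) := by ring
      rw [e, List.getD_append_right _ _ _ _ (by rw [hg]; omega), hg, Nat.add_sub_cancel_left,
        ih (by simpa using hi)]
      rfl

namespace Instance

variable (I : Instance)

theorem encode_zero : I.encode.getD 0 0 = I.n := rfl

theorem encode_one : I.encode.getD 1 0 = I.s.val := rfl

open Classical in
theorem encode_adj (u v : Fin I.n) :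
    I.encode.getD (2 + (I.n * u.val + v.val)) 0 = if I.G.Adj u v then 1 else 0 := by
  have hlen : ((List.finRange I.n).flatMap fun i =>
      (List.finRange I.n).map fun j => if I.G.Adj i j then 1 else 0).length = I.n * I.n := by
    simp [List.length_flatMap]
  have h1 : u.val * I.n + v.val < I.n * I.n := by
    have h2 : (u.val + 1) * I.n ≤ I.n * I.n := Nat.mul_le_mul_right _ u.2
    rw [Nat.add_mul, Nat.one_mul] at h2
    have := v.2
    omega
  rw [mul_comm, encode, List.append_assoc, List.append_assoc,
    List.getD_append_right _ _ _ _ (by simp),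
    List.getD_append _ _ _ _ (by simp only [List.length_cons, List.length_nil]; omega)]
  simp only [List.length_cons, List.length_nil, Nat.zero_add, Nat.add_sub_cancel_left]
  rw [getD_flatMap (n := I.n) _ (by simp) _ (by simp) v.2]
  simp [List.getD_eq_getElem?_getD]

open Classical in
theorem encode_weight (v : Fin I.n) :
    I.encode.getD (2 + (I.n * I.n + (I.n + v.val))) 0 =
      if h : v ∈ I.S then I.w ⟨v, h⟩ else 0 := by
  have hlen : ((List.finRange I.n).flatMap fun i =>
      (List.finRange I.n).map fun j => if I.G.Adj i j then 1 else 0).length = I.n * I.n := by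
    simp [List.length_flatMap]
  rw [encode, List.append_assoc, List.append_assoc,
    List.getD_append_right _ _ _ _ (by simp),
    List.getD_append_right _ _ _ _ (by simp only [List.length_cons, List.length_nil]; omega),
    hlen, List.getD_append_right _ _ _ _ (by simp only [List.length_cons, List.length_nil,
      List.length_map, List.length_finRange]; omega)]
  have e : 2 + (I.n * I.n + (I.n + v.val)) - ([I.n, I.s.val] : List ℕ).length - I.n * I.n -
      ((List.finRange I.n).map fun v => if v ∈ I.S then 1 else 0).length = v.val := by
    simp only [List.length_cons, List.length_nil, List.length_map, List.length_finRange]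
    omega
  rw [e]
  simp [List.getD_eq_getElem?_getD]

/-- Each entry contributes at least its separator bit, and the list has at least `n` entries. -/
theorem n_le_bitLength : I.n ≤ bitLength I.encode := by
  have h1 : I.encode.length ≤ bitLength I.encode := by
    rw [bitLength]
    have := List.card_nsmul_le_sum (I.encode.map fun x => Nat.size x + 1) 1 (by simp)
    simpa only [List.length_map, smul_eq_mul, mul_one] using this
  refine le_trans ?_ h1
  simp [encode]
  omega

theorem bd_n : Bd encode fun I => I.n :=
  ⟨(PT.const 0).input.congr fun I _ _ => I.encode_zero.symm, Polynomial.X, fun I => by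
    rw [Polynomial.eval_X]; exact I.n_le_bitLength⟩

theorem pt_s {m : ℕ} : PT encode (m := m) fun I _ _ => I.s.val :=
  (PT.const 1).input.congr fun I _ _ => I.encode_one.symm

/-- The adjacency relation, as a relation on natural numbers. -/
def adj (u v : ℕ) : Prop := ∃ (hu : u < I.n) (hv : v < I.n), I.G.Adj ⟨u, hu⟩ ⟨v, hv⟩

theorem pp_adj : PP encode (m := 2) fun I _ v => I.adj (v 0) (v 1) := by
  refine ((PP.lt (.var 0) bd_n.pt).and ((PP.lt (.var 1) bd_n.pt).and (.ne_zero
    (PT.input ((PT.const 2).add ((PT.mulBd bd_n (.var 0)).add (.var 1))))))).congr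
    fun I _ v => ?_
  constructor
  · rintro ⟨hu, hv, h⟩
    refine ⟨hu, hv, ?_⟩
    have := I.encode_adj ⟨v 0, hu⟩ ⟨v 1, hv⟩
    dsimp only at this
    rw [this, if_pos h]
    exact one_ne_zero
  · rintro ⟨hu, hv, h⟩
    refine ⟨hu, hv, ?_⟩
    have h1 := I.encode_adj ⟨v 0, hu⟩ ⟨v 1, hv⟩
    dsimp only at h1
    by_contra h2
    rw [if_neg h2] at h1
    exact h h1

open Classical in
/-- The weight of a vertex, `0` for vertices outside `S`. -/
noncomputable def weight (v : Fin I.n) : ℕ := if h : v ∈ I.S then I.w ⟨v, h⟩ else 0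

/-- The weight of a vertex, as a function on natural numbers. -/
noncomputable def natWeight (v : ℕ) : ℕ := if h : v < I.n then I.weight ⟨v, h⟩ else 0

theorem pt_natWeight : PT encode (m := 1) fun I _ v => I.natWeight (v 0) := by
  classical
  refine (PT.ite (P := fun I _ (v : Fin 1 → ℕ) => v 0 < I.n)
    (PP.lt (g := fun (I : Instance) _ _ => I.n) (.var 0) bd_n.pt)
    (PT.input ((PT.const 2).add ((PT.mulBd bd_n bd_n.pt).add (bd_n.pt.add (.var 0)))))
    (.const 0)).congr fun I _ v => ?_
  rw [natWeight]
  split_ifs with h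
  · exact (I.encode_weight ⟨v 0, h⟩).symm
  · rfl

/-! ### Distances and dominators -/

open Classical in
/-- `reach u i v` is not `0` if there is a walk of length at most `i` from `s` to `v` which does not
pass through `u`. -/
noncomputable def reach (u : ℕ) : ℕ → ℕ → ℕ
  | 0, v => if v = I.s.val ∧ v ≠ u then 1 else 0
  | i + 1, v => if reach u i v ≠ 0 ∨ ∃ w < I.n, reach u i w ≠ 0 ∧ I.adj w v ∧ v ≠ u then 1 else 0

theorem reach_iff (u i v : ℕ) : I.reach u i v ≠ 0 ↔
    ∃ (hv : v < I.n) (w : I.G.Walk ⟨v, hv⟩ I.s), w.length ≤ i ∧ ∀ x ∈ w.support, x.val ≠ u := by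
  classical
  have key : ∀ {P : Prop} [Decidable P], (if P then 1 else 0) ≠ 0 ↔ P := fun {P} _ => by
    split_ifs <;> simp [*]
  induction i generalizing v with
  | zero =>
    rw [reach, key]
    constructor
    · rintro ⟨rfl, h⟩
      exact ⟨I.s.2, .nil, le_rfl, by simpa using h⟩
    · rintro ⟨hv, w, hw, h⟩
      have h1 := w.eq_of_length_eq_zero (by omega)
      exact ⟨congrArg Fin.val h1, h _ w.start_mem_support⟩
  | succ i ih =>
    rw [reach, key, or_congr_left (ih v)]
    constructor
    · rintro (⟨hv, w, hw, h⟩ | ⟨x, hx, hxr, ⟨_, hv, hadj⟩, hne⟩)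
      · exact ⟨hv, w, by omega, h⟩
      · obtain ⟨_, w, hw, h⟩ := (ih x).1 hxr
        refine ⟨hv, .cons hadj.symm w, by simpa using hw, fun y hy => ?_⟩
        rw [Walk.support_cons, List.mem_cons] at hy
        obtain rfl | hy := hy
        · exact hne
        · exact h y hy
    · rintro ⟨hv, w, hw, h⟩
      by_cases hi : w.length ≤ i
      · exact Or.inl ⟨hv, w, hi, h⟩
      · refine Or.inr ?_
        generalize hs : I.s = s' at w
        cases w with
        | nil => simp at hi
        | @cons _ c _ hvc w =>
          subst hs
          refine ⟨c.val, c.2, (ih _).2 ⟨c.2, w, by simpa using hw, fun x hx => h x ?_⟩,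
            ⟨c.2, hv, hvc.symm⟩, h ⟨v, hv⟩ (by simp)⟩
          rw [Walk.support_cons]
          exact List.mem_cons_of_mem _ hx

/-- `reach`, restricted to vertices and to lengths which matter. -/
noncomputable def reachN (u i v : ℕ) : ℕ := if v < I.n then I.reach u (min i I.n) v else 0

theorem pt_reachN : PT encode (m := 3) fun I _ v => I.reachN (v 0) (v 1) (v 2) := by
  classical
  have h : PT encode (m := 1 + 2) fun I _ (v : Fin 3 → ℕ) =>
      if v 2 < I.n then I.reach (v 0) (min (v 1) I.n) (v 2) else 0 := by
    refine (PT.iter (m := 3) bd_n bd_n (Row := fun I v i x => I.reach (v 0) i x)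
      (H := fun I A v _ x => if A x ≠ 0 ∨ ∃ w < I.n, A w ≠ 0 ∧ I.adj w x ∧ x ≠ v 0 then 1 else 0)
      ?_ ?_ ?_ (.var 1) (.var 2))
    · exact PT.ite ((PP.eq (.var 0) pt_s).and (PP.eq (.var 0) (.var 1)).not) (.const 1) (.const 0)
    · refine PT.ite (PP.or (.ne_zero (PT.var 0).oracle) (PP.ex bd_n
        (P := fun I A (v : Fin 5 → ℕ) w => A w ≠ 0 ∧ I.adj w (v 0) ∧ v 0 ≠ v 2)
        ((PP.ne_zero (PT.var 0).oracle).and ((pp_adj.comp₂ (.var 0) (.var 1)).and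
          (PP.eq (.var 1) (.var 3)).not)))) (.const 1) (.const 0)
    · intro I v i x A hx hA
      rw [reach, hA x hx]
      refine if_congr (or_congr Iff.rfl ⟨?_, ?_⟩) rfl rfl
      · rintro ⟨w, hw, h⟩
        exact ⟨w, hw, by rwa [← hA w hw]⟩
      · rintro ⟨w, hw, h⟩
        exact ⟨w, hw, by rwa [hA w hw]⟩
  exact h

open Classical in
/-- The distance of a vertex from `s`, as a function on natural numbers. -/
noncomputable def level (v : ℕ) : ℕ :=
  ∑ i ∈ Finset.range I.n, if I.reachN I.n i v = 0 then 1 else 0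

theorem pt_level : PT encode (m := 1) fun I _ v => I.level (v 0) := by
  classical
  exact PT.sum bd_n (f := fun I _ (v : Fin 1 → ℕ) i => if I.reachN I.n i (v 0) = 0 then 1 else 0)
    (PT.ite (.eq (PT.comp₃ pt_reachN bd_n.pt (.var 0) (.var 1)) (.const 0)) (.const 1) (.const 0))

/-- The forbidden number `I.n` is not a vertex, so nothing is forbidden and the sum counts the `i`
that are too small to reach `v`. -/
theorem level_eq (hG : I.G.Connected) (v : Fin I.n) : I.level v.val = I.G.dist I.s v := by
  have key : ∀ i ∈ Finset.range I.n, (I.reachN I.n i v.val = 0 ↔ i < I.G.dist I.s v) := by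
    intro i hi
    rw [Finset.mem_range] at hi
    rw [reachN, if_pos v.2, min_eq_left hi.le, ← not_iff_not, ← ne_eq, reach_iff, not_lt]
    constructor
    · rintro ⟨_, w, hw, -⟩
      rw [dist_comm]
      exact (dist_le w).trans hw
    · intro h
      obtain ⟨w, hw⟩ := hG.exists_walk_length_eq_dist v I.s
      exact ⟨v.2, w, by rw [hw, dist_comm]; exact h, fun x _ => x.2.ne⟩
  have hlt : I.G.dist I.s v < I.n := by simpa using dist_lt_card (s := I.s) hG v
  rw [level, Finset.sum_boole, Finset.filter_congr key]
  have : ((Finset.range I.n).filter fun i => i < I.G.dist I.s v)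
      = Finset.range (I.G.dist I.s v) := by
    ext i
    simp only [Finset.mem_filter, Finset.mem_range]
    omega
  rw [this, Finset.card_range]
  rfl

/-- The relation `Dominates`, as a relation on natural numbers. -/
def dom (u v : ℕ) : Prop := I.reachN u I.n v = 0

theorem pp_dom : PP encode (m := 2) fun I _ v => I.dom (v 0) (v 1) :=
  .eq (PT.comp₃ pt_reachN (.var 0) bd_n.pt (.var 1)) (.const 0)

theorem dom_iff (u v : Fin I.n) : I.dom u.val v.val ↔ Dominates I.G I.s u v := by
  classical
  rw [dom, reachN, if_pos v.2, min_self, ← not_iff_not, ← ne_eq, reach_iff, Dominates]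
  push Not
  constructor
  · rintro ⟨_, w, -, hw⟩
    refine ⟨w.reverse, fun h => hw u ?_ rfl⟩
    simpa using h
  · rintro ⟨w, hw⟩
    -- A walk avoiding `u` contains a path avoiding `u`, of length less than `n`; so the length
    -- bound in `dom` loses nothing.
    refine ⟨v.2, w.reverse.bypass, ?_, fun x hx h => hw ?_⟩
    · have := (w.reverse.bypass_isPath).length_lt
      simpa using this.le
    · have h1 := w.reverse.support_bypass_subset_support hx
      rw [Walk.support_reverse, List.mem_reverse] at h1
      rwa [← Fin.ext h]

end Instance

end Firefighter

namespace Firefighter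

open SimpleGraph RAM

/-! ### Codes of small sets -/

/-- The number `u` is a member of the set of at most `K` numbers with the code `y`, in base `N`. -/
def Member (N M : ℕ) : ℕ → ℕ → ℕ → Prop
  | 0, _, _ => False
  | K + 1, u, y => ∃ q < M, ∃ r < N, y = N * q + r ∧ (r = u + 1 ∨ Member N M K u q)

theorem not_member_zero {N M : ℕ} (hN : 0 < N) (K u : ℕ) : ¬ Member N M K u 0 := by
  induction K with
  | zero => exact id
  | succ K ih =>
    rintro ⟨q, -, r, -, h1, h2⟩
    have h3 : N * q = 0 := by omega
    obtain rfl : q = 0 := by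
      rcases Nat.mul_eq_zero.1 h3 with h | h
      · omega
      · exact h
    exact h2.elim (fun h => by omega) ih

/-- The elements are written as base `N` digits `u + 1`, and the digit `0` marks an unused place; so
sets with fewer than `K` elements have codes too, and `0` codes the empty set. -/
theorem exists_code {N M : ℕ} (K : ℕ) (hM : N ^ K ≤ M) (l : List ℕ) (hl : l.length ≤ K)
    (hN : 0 < N) (hlN : ∀ u ∈ l, u + 1 < N) : ∃ y < N ^ K, ∀ u, Member N M K u y ↔ u ∈ l := by
  induction K generalizing l with
  | zero =>
    obtain rfl := List.eq_nil_of_length_eq_zero (Nat.le_zero.1 hl)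
    exact ⟨0, by simp, by simp [Member]⟩
  | succ K ih =>
    cases l with
    | nil => exact ⟨0, by positivity, fun u => by simp [not_member_zero hN]⟩
    | cons a l =>
      have hle : N ^ K ≤ N ^ (K + 1) := Nat.pow_le_pow_right hN (by omega)
      obtain ⟨y, hy, h⟩ := ih (hle.trans hM) l (by simpa using hl)
        fun u hu => hlN u (List.mem_cons_of_mem _ hu)
      have ha := hlN a (by simp)
      refine ⟨N * y + (a + 1), ?_, fun u => ?_⟩
      · rw [pow_succ']
        have := Nat.mul_le_mul_left N (show y + 1 ≤ N ^ K from hy)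
        rw [Nat.mul_add] at this
        omega
      · rw [List.mem_cons, ← h]
        constructor
        · rintro ⟨q, -, r, hr, h1, h2⟩
          have h3 := congrArg (· % N) h1
          have h4 := congrArg (· / N) h1
          simp only [Nat.mul_add_mod, Nat.mod_eq_of_lt ha, Nat.mod_eq_of_lt hr,
            Nat.mul_add_div hN, Nat.div_eq_of_lt ha, Nat.div_eq_of_lt hr, Nat.add_zero] at h3 h4
          rw [h4]
          exact h2.imp (fun h => by omega) id
        · exact fun h => ⟨y, by omega, a + 1, ha, rfl, h.imp (fun h => by omega) id⟩

/-- As `K` is fixed, `Member` unfolds to `K` nested searches for quotient and remainder, which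
replace division. -/
theorem pp_member {ι : Type} {enc : ι → List ℕ} {N M : ι → ℕ} (hN : Bd enc N) (hM : Bd enc M)
    (K : ℕ) : PP enc (m := 2) fun I _ v => Member (N I) (M I) K (v 0) (v 1) := by
  induction K with
  | zero => exact (PP.lt (.const 0) (.const 0)).congr fun _ _ _ => by simp [Member]
  | succ K ih =>
    exact PP.ex hM (P := fun I _ (v : Fin 2 → ℕ) q => ∃ r < N I, v 1 = N I * q + r ∧
        (r = v 0 + 1 ∨ Member (N I) (M I) K (v 0) q)) <|
      PP.ex hN (P := fun I _ (v : Fin 3 → ℕ) r => v 2 = N I * v 0 + r ∧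
        (r = v 1 + 1 ∨ Member (N I) (M I) K (v 1) (v 0))) <|
      (PP.eq (.var 3) ((PT.mulBd hN (.var 1)).add (.var 0))).and <|
      (PP.eq (.var 0) ((PT.var 2).add (.const 1))).or (PP.comp₂ ih (.var 2) (.var 1))

namespace Instance

/-! ### The layered graph -/

/-- The number of codes of sets of at most `K` vertices. -/
def numCodes (K : ℕ) (I : Instance) : ℕ := (I.n + 1) ^ K

/-- The vertex `u` is a member of the set with the code `y`. -/
def member (K : ℕ) (I : Instance) (u y : ℕ) : Prop := Member (I.n + 1) (I.numCodes K) K u y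

open Classical in
/-- The set `y` of protected vertices may follow the set `x`, if the vertices at distance at most
`i` are dealt with before the step and the vertices at distance `i + 1` in the step. -/
def Step (b K : ℕ) (I : Instance) (i x y : ℕ) : Prop :=
  (∀ u < I.n, I.member K u y → I.member K u x ∨ I.level u = i + 1) ∧
    (∑ u ∈ Finset.range I.n, if I.member K u y ∧ I.level u = i + 1 then 1 else 0) ≤ b

open Classical in
/-- The total weight of the vertices at distance `i + 1` which are dominated by a member of `y`. -/
noncomputable def gain (K : ℕ) (I : Instance) (i y : ℕ) : ℕ :=
  ∑ v ∈ Finset.range I.n,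
    if I.level v = i + 1 ∧ ∃ u < I.n, I.member K u y ∧ I.dom u v then I.natWeight v else 0

/-- An optimal sequence of sets of protected vertices. -/
noncomputable def best (b K : ℕ) (I : Instance) (i : ℕ) : ℕ :=
  bestPath (I.Step b K) (I.gain K) I.n (I.numCodes K) (min i I.n)

/-- The vertex `v` is protected by the optimal strategy. -/
def Chosen (b K : ℕ) (I : Instance) (v : ℕ) : Prop :=
  I.level v ≠ 0 ∧ I.member K v (I.best b K (I.level v))

section Complexity

variable (b K : ℕ)

theorem bd_numCodes : Bd encode (numCodes K) := (bd_n.add (Bd.const 1)).pow K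

theorem pp_mem : PP encode (m := 2) fun I _ v => I.member K (v 0) (v 1) :=
  pp_member (bd_n.add (Bd.const 1)) (bd_numCodes K) K

theorem pp_step : PP encode (m := 3) fun I _ v => I.Step b K (v 0) (v 1) (v 2) := by
  classical
  refine PP.and (PP.all bd_n
    (P := fun I _ (v : Fin 3 → ℕ) u =>
      I.member K u (v 2) → I.member K u (v 1) ∨ I.level u = v 0 + 1)
    (((pp_mem K).comp₂ (.var 0) (.var 3)).imp (((pp_mem K).comp₂ (.var 0) (.var 2)).or
      (.eq (pt_level.comp₁ (.var 0)) ((PT.var 1).add (.const 1))))))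
    (PP.le (PT.sum bd_n (f := fun I _ (v : Fin 3 → ℕ) u =>
      if I.member K u (v 2) ∧ I.level u = v 0 + 1 then 1 else 0)
    (PT.ite (((pp_mem K).comp₂ (.var 0) (.var 3)).and
      (.eq (pt_level.comp₁ (.var 0)) ((PT.var 1).add (.const 1)))) (.const 1) (.const 0)))
    (.const b))

theorem pt_gain : PT encode (m := 2) fun I _ v => I.gain K (v 0) (v 1) := by
  classical
  exact PT.sum bd_n (f := fun I _ (w : Fin 2 → ℕ) v =>
    if I.level v = w 0 + 1 ∧ ∃ u < I.n, I.member K u (w 1) ∧ I.dom u v then I.natWeight v else 0) <|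
    PT.ite ((PP.eq (pt_level.comp₁ (.var 0)) ((PT.var 1).add (.const 1))).and <|
      PP.ex bd_n (P := fun I _ (w : Fin 3 → ℕ) u => I.member K u (w 2) ∧ I.dom u (w 0)) <|
      ((pp_mem K).comp₂ (.var 0) (.var 3)).and (pp_dom.comp₂ (.var 0) (.var 1)))
    (pt_natWeight.comp₁ (.var 0)) (.const 0)

theorem pp_chosen : PP encode (m := 1) fun I _ v => I.Chosen b K (v 0) :=
  PP.and (.ne_zero pt_level) <| (pp_mem K).comp₂ (.var 0)
    (PT.bestPath bd_n (bd_numCodes K) (pp_step b K) (pt_gain K) pt_level)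

end Complexity

/-! ### Correctness -/

variable {I : Instance} {b K : ℕ}

theorem numCodes_pos : 0 < I.numCodes K := by
  unfold numCodes
  positivity

theorem not_member_empty (u : ℕ) : ¬ I.member K u 0 := not_member_zero (Nat.succ_pos _) _ _

/-- Forgetting all vertices is always allowed; this is the condition on node `0` needed for the
layered graph. -/
theorem step_zero (i x : ℕ) : I.Step b K i x 0 :=
  ⟨fun u _ h => absurd h (not_member_empty u), by simp [not_member_empty]⟩

open Classical in
theorem value_eq (Φ : Finset (Fin I.n × ℕ)) :
    I.value Φ = ∑ v : Fin I.n, if Saved I.G I.s Φ v then I.weight v else 0 := by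
  have h1 : I.value Φ = ∑ v ∈ I.S.attach, (if Saved I.G I.s Φ v.1 then I.weight v.1 else 0) := by
    unfold value
    refine Finset.sum_congr rfl fun v _ => ?_
    rw [weight, dif_pos v.2]
  rw [h1, Finset.sum_attach I.S fun v => if Saved I.G I.s Φ v then I.weight v else 0]
  refine Finset.sum_subset (Finset.subset_univ _) fun v _ hv => ?_
  rw [weight, dif_neg hv, ite_self]

-- Each vertex other than `s` is counted at exactly one stage, namely when its own distance is
-- reached.
open Classical in
theorem sum_gain (hG : I.G.Connected) (q : ℕ → ℕ) :
    ∑ i ∈ Finset.range I.n, I.gain K i (q (i + 1)) = ∑ v : Fin I.n,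
      if I.level v ≠ 0 ∧ ∃ u : Fin I.n, I.member K u (q (I.level v)) ∧ Dominates I.G I.s u v
      then I.weight v else 0 := by
  unfold gain
  rw [Finset.sum_comm, Finset.sum_range]
  refine Finset.sum_congr rfl fun v _ => ?_
  have hw : I.natWeight v = I.weight v := by rw [natWeight, dif_pos v.2]
  have hlt : I.level v.val < I.n := by
    rw [level_eq _ hG]
    simpa using dist_lt_card (s := I.s) hG v
  have hdom : ∀ y, (∃ u < I.n, I.member K u y ∧ I.dom u v) ↔
      ∃ u : Fin I.n, I.member K u y ∧ Dominates I.G I.s u v := by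
    intro y
    constructor
    · rintro ⟨u, hu, h1, h2⟩
      exact ⟨⟨u, hu⟩, h1, (I.dom_iff ⟨u, hu⟩ v).1 h2⟩
    · rintro ⟨u, h1, h2⟩
      exact ⟨u, u.2, h1, (I.dom_iff u v).2 h2⟩
  rw [hw]
  simp only [hdom]
  cases hl : I.level v.val with
  | zero => simp
  | succ j =>
    rw [Finset.sum_eq_single j]
    · simp
    · intro i _ hi
      rw [if_neg]
      rintro ⟨h, -⟩
      omega
    · intro h
      rw [Finset.mem_range] at h
      omega

theorem best_step {i : ℕ} (hi : i < I.n) :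
    I.Step b K i (I.best b K i) (I.best b K (i + 1)) := by
  have := bestPath_rel (gain := I.gain K) (numCodes_pos (I := I) (K := K))
    (step_zero (I := I) (b := b) (K := K)) hi
  rwa [best, best, min_eq_left hi.le, min_eq_left (show i + 1 ≤ I.n from hi)]

/-- Tracing `u` back along the path, which starts with the empty set, it must have entered at the
stage of its own distance. -/
theorem chosen_of_member {i u : ℕ} (hi : i ≤ I.n) (hu : u < I.n)
    (h : I.member K u (I.best b K i)) : I.Chosen b K u := by
  induction i with
  | zero => exact absurd h (not_member_empty u)
  | succ i ih =>
    obtain h1 | h1 := (best_step hi).1 u hu h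
    · exact ih (by omega) h1
    · exact ⟨by omega, by rwa [h1]⟩

open Classical in
/-- The set of vertices protected by the optimal strategy. -/
noncomputable def chosenSet (b K : ℕ) (I : Instance) : Finset (Fin I.n) :=
  Finset.univ.filter fun v => I.Chosen b K v

theorem mem_chosenSet {v : Fin I.n} : v ∈ I.chosenSet b K ↔ I.Chosen b K v := by
  simp [chosenSet]

theorem s_not_mem_chosenSet (hG : I.G.Connected) : I.s ∉ I.chosenSet b K := by
  intro h
  have h1 := (mem_chosenSet.1 h).1
  rw [level_eq _ hG, SimpleGraph.dist_self] at h1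
  exact h1 rfl

open Classical in
theorem card_level_le (hG : I.G.Connected) (s : Finset (Fin I.n)) (y i : ℕ)
    (hs : ∀ u : Fin I.n, u ∈ s ↔ I.member K u y ∧ I.G.dist I.s u = i) :
    (∑ u ∈ Finset.range I.n, if I.member K u y ∧ I.level u = i then 1 else 0) = s.card := by
  rw [Finset.sum_range, ← Finset.card_filter]
  congr 1
  ext u
  rw [hs, Finset.mem_filter, level_eq _ hG]
  simp

theorem isValidStrategy_chosenSet (hG : I.G.Connected) :
    IsValidStrategy I.G I.s b (levelStrategy I.G I.s (I.chosenSet b K)) := by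
  classical
  refine isValidStrategy_levelStrategy hG (s_not_mem_chosenSet hG) fun t => ?_
  by_cases ht : t = 0 ∨ I.n < t
  · rw [Finset.filter_false_of_mem]
    · simp
    · intro u hu h
      have h1 := (mem_chosenSet.1 hu).1
      rw [level_eq _ hG] at h1
      have : I.G.dist I.s u < I.n := by simpa using dist_lt_card (s := I.s) hG u
      omega
  · obtain ⟨i, rfl⟩ : ∃ i, t = i + 1 := ⟨t - 1, by omega⟩
    refine le_trans (le_of_eq ?_) (best_step (I := I) (b := b) (K := K) (i := i) (by omega)).2
    refine (card_level_le hG _ _ _ fun u => ?_).symm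
    rw [Finset.mem_filter, mem_chosenSet, Chosen, level_eq _ hG]
    constructor
    · rintro ⟨⟨-, h1⟩, h2⟩
      exact ⟨by rwa [h2] at h1, h2⟩
    · rintro ⟨h1, h2⟩
      exact ⟨⟨by omega, by rwa [h2]⟩, h2⟩

/-- A vertex counted in the gain is dominated by a member of the current set, hence by a chosen
vertex. Only an inequality holds in general, since a path may forget a chosen vertex that still
saves others. -/
theorem sum_gain_le_value (hG : I.G.Connected) :
    ∑ i ∈ Finset.range I.n, I.gain K i (I.best b K (i + 1))
      ≤ I.value (levelStrategy I.G I.s (I.chosenSet b K)) := by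
  classical
  rw [sum_gain hG, value_eq]
  refine Finset.sum_le_sum fun v _ => ?_
  split_ifs with h1 h2 h2
  · exact le_rfl
  · obtain ⟨-, u, hu, huv⟩ := h1
    have hlt : I.level v.val ≤ I.n := by
      rw [level_eq _ hG]
      simpa using (dist_lt_card (s := I.s) hG v).le
    exact absurd (saved_levelStrategy hG (s_not_mem_chosenSet hG)
      (mem_chosenSet.2 (chosen_of_member hlt u.2 hu)) huv) h2
  · exact Nat.zero_le _
  · exact le_rfl

theorem value_le_sum_gain {k : ℕ} (hG : I.G.IsTree) (hn : IsNarrow k I.G I.s)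
    (hK : b * k + (k + 3) ≤ K) {Φ : Finset (Fin I.n × ℕ)} (hΦ : IsValidStrategy I.G I.s b Φ) :
    I.value Φ ≤ ∑ i ∈ Finset.range I.n, I.gain K i (I.best b K (i + 1)) := by
  classical
  obtain ⟨U, hs, hb, hanti, hsaved⟩ := exists_antichain hG hΦ
  have hcode : ∀ i, ∃ y < I.numCodes K, ∀ u, I.member K u y ↔
      u ∈ (active I.G I.s U i).toList.map Fin.val := by
    intro i
    refine exists_code K le_rfl _ ?_ (Nat.succ_pos _) ?_
    · rw [List.length_map, Finset.length_toList]
      exact (card_active_le hG.connected hn hb hanti i).trans hK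
    · intro u hu
      obtain ⟨v, -, rfl⟩ := List.mem_map.1 hu
      exact Nat.succ_lt_succ v.2
  choose q' hq' hq'mem using hcode
  have h0 : active I.G I.s U 0 = ∅ := by
    rw [Finset.eq_empty_iff_forall_notMem]
    intro u hu
    obtain ⟨hu, v, hv, huv⟩ := mem_active.1 hu
    have h1 := huv.eq_of_dist_le hG.connected (by omega)
    rw [← h1] at hv
    rw [hG.connected.dist_eq_zero_iff] at hv
    exact hs (hv ▸ hu)
  -- Paths start at node `0`, while `exists_code` gives some code of the empty set `active I.G I.s U
  -- 0`, not necessarily `0`.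
  set q : ℕ → ℕ := fun i => if i = 0 then 0 else q' i with hq
  have hqlt : ∀ i, q i < I.numCodes K := by
    intro i
    rw [hq]
    dsimp only
    split_ifs
    · exact numCodes_pos
    · exact hq' i
  have hqmem : ∀ i (u : Fin I.n), I.member K u (q i) ↔ u ∈ active I.G I.s U i := by
    intro i u
    rw [hq]
    dsimp only
    split_ifs with hi
    · subst hi
      rw [h0]
      exact iff_of_false (not_member_empty _) (by simp)
    · rw [hq'mem, List.mem_map]
      simp only [Finset.mem_toList]
      constructor
      · rintro ⟨v, hv, hvu⟩
        rwa [← Fin.ext hvu]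
      · exact fun h => ⟨u, h, rfl⟩
  have hstep : ∀ i < I.n, I.Step b K i (q i) (q (i + 1)) := by
    intro i _
    refine ⟨fun u hu h => ?_, le_trans (le_of_eq (card_level_le hG.connected
      ((active I.G I.s U (i + 1)).filter fun u => I.G.dist I.s u = i + 1) _ _ fun u => ?_)) ?_⟩
    · obtain h1 | h1 := active_succ hG.connected ((hqmem (i + 1) ⟨u, hu⟩).1 h)
      · exact Or.inl ((hqmem i ⟨u, hu⟩).2 h1)
      · exact Or.inr ((I.level_eq hG.connected ⟨u, hu⟩).trans h1)
    · rw [Finset.mem_filter, hqmem]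
    · exact (Finset.card_le_card
        (Finset.filter_subset_filter _ fun u hu => (mem_active.1 hu).1)).trans (hb (i + 1))
  have hopt := sum_le_sum_bestPath (gain := I.gain K) numCodes_pos step_zero
    (show q 0 = 0 from rfl) hqlt hstep
  have hbest : ∑ i ∈ Finset.range I.n, I.gain K i (I.best b K (i + 1)) = ∑ i ∈ Finset.range I.n,
      I.gain K i (bestPath (I.Step b K) (I.gain K) I.n (I.numCodes K) (i + 1)) := by
    refine Finset.sum_congr rfl fun i hi => ?_
    rw [best, min_eq_left (show i + 1 ≤ I.n from Finset.mem_range.1 hi)]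
  rw [hbest]
  refine le_trans ?_ hopt
  rw [sum_gain hG.connected, value_eq]
  refine Finset.sum_le_sum fun v _ => ?_
  split_ifs with h1 h2 h2
  · exact le_rfl
  · refine absurd ?_ h2
    obtain ⟨u, hu, huv⟩ := hsaved v h1
    have hact : u ∈ active I.G I.s U (I.G.dist I.s v) :=
      mem_active.2 ⟨hu, v, rfl, huv⟩
    rw [I.level_eq hG.connected]
    refine ⟨fun h => ?_, u, (hqmem _ u).2 hact, huv⟩
    rw [h, h0] at hact
    simp at hact
  · exact Nat.zero_le _
  · exact le_rfl

theorem isOptimal_chosenSet {k : ℕ} (hG : I.G.IsTree) (hn : IsNarrow k I.G I.s)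
    (hK : b * k + (k + 3) ≤ K) :
    I.IsOptimal b (levelStrategy I.G I.s (I.chosenSet b K)) :=
  ⟨isValidStrategy_chosenSet hG.connected, fun _ hΨ =>
    (value_le_sum_gain hG hn hK hΨ).trans (sum_gain_le_value hG.connected)⟩

end Instance

/-! ### The printed answer and the theorem -/

theorem encodePairs_map {n : ℕ} (P : ℕ → Prop) [DecidablePred P] (g : ℕ → ℕ) (l : List (Fin n)) :
    (l.map Fin.val).flatMap (fun i => if P i then [i, g i] else []) =
      encodePairs ((l.filter fun v => P v.val).map fun v => (v, g v.val)) := by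
  induction l with
  | nil => rfl
  | cons a l ih =>
    rw [List.map_cons, List.flatMap_cons, ih, List.filter_cons]
    by_cases h : P a.val <;> simp [h, encodePairs]

end Firefighter

open RAM Firefighter Instance in
theorem mainTheorem8 (k b : ℕ) (hk : 1 ≤ k) (hb : 1 ≤ b) :
    RAM.SolvableInPolyTime
      (fun I : {I : Firefighter.Instance // Firefighter.IsCaterpillar k I.G} => I.1.encode)
      (fun I ys => ∃ L : List (Fin I.1.n × ℕ),
        L.Nodup ∧ I.1.IsOptimal b L.toFinset ∧ ys = Firefighter.encodePairs L) := by
  classical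
  -- The program runs in polynomial time on every graph; being a caterpillar matters only for the
  -- correctness of its answer.
  have key : SolvableInPolyTime Instance.encode fun I ys => IsCaterpillar k I.G →
      ∃ L : List (Fin I.n × ℕ), L.Nodup ∧ I.IsOptimal b L.toFinset ∧ ys = encodePairs L := by
    refine solvable_of_list bd_n (pp_chosen b (b * k + (k + 3))) pt_level fun I hI => ?_
    have hG := hI.isTree
    rw [← List.map_coe_finRange_eq_range, encodePairs_map]
    refine ⟨_, ?_, ?_, rfl⟩
    · exact ((List.nodup_finRange _).filter _).map fun u v h => congrArg Prod.fst h
    · convert isOptimal_chosenSet hG (hI.isNarrow I.s) (le_refl (b * k + (k + 3))) using 1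
      ext ⟨v, t⟩
      rw [mem_levelStrategy, mem_chosenSet]
      simp only [List.mem_toFinset, List.mem_map, List.mem_filter, List.mem_finRange, true_and,
        decide_eq_true_eq, Prod.mk.injEq]
      constructor
      · rintro ⟨u, hu, rfl, rfl⟩
        exact ⟨hu, level_eq _ hG.connected u⟩
      · rintro ⟨h1, rfl⟩
        exact ⟨v, h1, rfl, level_eq _ hG.connected v⟩
  obtain ⟨c, p, h⟩ := key
  refine ⟨c, p, fun I => ?_⟩
  obtain ⟨t, τ, h1, h2, h3⟩ := h I.1
  exact ⟨t, τ, h1, h2, h3 I.2⟩
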